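/- Let $d\ge 1$. Let $\mathcal D(\mathbb R^d)$ be the space of smooth compactly supported functions and $\mathcal D'(\mathbb R^d)$ the space of (complex-valued) distributions. For $r\in\mathbb N_0$ let $\mathcal B^r$ be the set of $\psi\in\mathcal D(\mathbb R^d)$ supported in the open unit ball $B(0,1)$ with $\|\psi\|_{C^r}\le 1$, i.e. all derivatives of order at most $r$ are bounded by $1$. For $m\in\mathbb N_0$ let $\mathcal B^r_m$ be the set of $\psi\in\mathcal B^r$ with $\int x^k\psi(x)\,dx=0$ for every multi-index $k$ with $0\le|k|\le m$. For $\lambda>0$ and $x\in\mathbb R^d$ put $\psi_x^{\lambda}(y)=\lambda^{-d}\psi\big(\tfrac{x-y}{\lambda}\big)$ and $\psi_x=\psi_x^1$. For $\alpha\ge 0$, $p,q\in[1,\infty]$ and $r\in\mathbb N_0$ with $r>-\alpha$, the local Besov space $B^\alpha_{p,q,\mathrm{loc}}(\mathbb R^d)$ is the set of $f\in\mathcal D'(\mathbb R^d)$ such that for every compact $K\subset\mathbb R^d$ $$\Big\|\sup_{\psi\in\mathcal B^r}|f(\psi_x)|\Big\|_{L^p(x\in K)}+\bigg\|\Big\|\sup_{\psi\in\mathcal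 B^r_{\lfloor\alpha\rfloor}}\frac{|f(\psi_x^{2^{-n}})|}{2^{-n\alpha}}\Big\|_{L^p(x\in K)}\bigg\|_{\ell^q(n\in\mathbb N_0)}<\infty ,$$ where $\lfloor\alpha\rfloor$ is the largest integer that is at most $\alpha$. For $s\in\mathbb R$, $H^s(\mathbb R^d)$ is the space of tempered distributions $u$ with $\mathcal F^{-1}\{(1+|\xi|^2)^{s/2}\,\widehat u\}\in L^2(\mathbb R^d)$, and $H^s_{\mathrm{loc}}(\mathbb R^d)$ is the set of $u\in\mathcal D'(\mathbb R^d)$ such that $\varphi u\in H^s(\mathbb R^d)$ for every $\varphi\in\mathcal D(\mathbb R^d)$. Let $\alpha\ge 0$, $p\in[2,\infty]$, and let $r\in\mathbb N_0$ with $r>-\alpha$ be arbitrary in the definition of the local Besov space. Then: (a) if $q\in(2,\infty]$, then $B^\alpha_{p,q,\mathrm{loc}}(\mathbb R^d)\subset H^s_{\mathrm{loc}}(\mathbb R^d)$ for every $s<\alpha$; (b) if $q=2$, then $B^\alpha_{p,2,\mathrm{loc}}(\mathbb R^d)\subset H^s_{\mathrm{loc}}(\mathbb R^d)$ for every $s\le\alpha$.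 -/

import Mathlib

open MeasureTheory
open scoped Distributions SchwartzMap ENNReal

noncomputable section

namespace BesovSobolev

/-- The open set `ℝ^d` as a domain of test functions. -/
abbrev whole (d : ℕ) : TopologicalSpace.Opens (EuclideanSpace ℝ (Fin d)) := ⊤

/-- The rescaled and recentred test function `ψ^λ_x(y) = λ^{-d} ψ((x - y) / λ)` for the dyadic
scale `λ = 2^{-n}`; for `n = 0` it is `ψ_x(y) = ψ(x - y)`. -/
def rescale {d : ℕ} (n : ℕ) (x : EuclideanSpace ℝ (Fin d)) (ψ : 𝓓(whole d, ℝ)) :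
    𝓓(whole d, ℝ) where
  toFun y := ((2 : ℝ) ^ n) ^ d * ψ ((2 : ℝ) ^ n • (x - y))
  contDiff' :=
    contDiff_const.mul (ψ.contDiff.comp ((contDiff_const.sub contDiff_id).const_smul _))
  hasCompactSupport' := by
    have h2 : (2 : ℝ) ^ n ≠ 0 := by positivity
    have h := ψ.hasCompactSupport.comp_homeomorph
      ((Homeomorph.subLeft x).trans (Homeomorph.smulOfNeZero ((2 : ℝ) ^ n) h2))
    exact h.mul_left
  tsupport_subset' := by simp [whole]

/-- The set `𝓑^r` of test functions supported in the open unit ball, all of whose derivatives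
of order at most `r` are bounded by `1`. -/
def unitTest (d r : ℕ) : Set 𝓓(whole d, ℝ) :=
  {ψ | tsupport ψ ⊆ Metric.ball 0 1 ∧ ∀ k ≤ r, ∀ x, ‖iteratedFDeriv ℝ k ψ x‖ ≤ 1}

/-- The set `𝓑^r_m` of those `ψ ∈ 𝓑^r` for which `∫ x^k ψ(x) dx = 0` for every multi-index `k`
with `|k| ≤ m`. -/
def unitTestMoments (d r m : ℕ) : Set 𝓓(whole d, ℝ) :=
  {ψ | ψ ∈ unitTest d r ∧
    ∀ k : Fin d → ℕ, ∑ i, k i ≤ m →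
      ∫ x : EuclideanSpace ℝ (Fin d), (∏ i, x i ^ k i) * ψ x = 0}

/-- `x ↦ sup_{ψ ∈ B} |f(ψ^{2^{-n}}_x)|`, with values in `[0, ∞]`. -/
def supTest {d : ℕ} (f : 𝓓'(whole d, ℂ)) (B : Set 𝓓(whole d, ℝ)) (n : ℕ)
    (x : EuclideanSpace ℝ (Fin d)) : ℝ≥0∞ :=
  ⨆ ψ ∈ B, ‖f (rescale n x ψ)‖ₑ

/-- The norm `‖ ‖ sup_{ψ ∈ B} |f(ψ^{2^{-n}}_x) / 2^{-nα}| ‖_{L^p(x ∈ K)} ‖_{ℓ^q(n ∈ ℕ)}`. -/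
def scaleNorm {d : ℕ} (f : 𝓓'(whole d, ℂ)) (B : Set 𝓓(whole d, ℝ)) (α : ℝ) (p q : ℝ≥0∞)
    (K : Set (EuclideanSpace ℝ (Fin d))) : ℝ≥0∞ :=
  eLpNorm (fun n : ℕ => eLpNorm (fun x => (2 : ℝ≥0∞) ^ ((n : ℝ) * α) * supTest f B n x) p
    (volume.restrict K)) q Measure.count

/-- The local Besov space `B^α_{p,q,loc}(ℝ^d)`, defined with test functions in `C^r`
(where `r > -α`). Here `⌊α⌋₊` is the largest natural number that is at most `α ≥ 0`. -/
def besovLoc (d : ℕ) (α : ℝ) (p q : ℝ≥0∞) (r : ℕ) : Set 𝓓'(whole d, ℂ) :=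
  {f | ∀ K : Set (EuclideanSpace ℝ (Fin d)), IsCompact K →
    if α < 0 then scaleNorm f (unitTest d r) α p q K < ∞
    else eLpNorm (supTest f (unitTest d r) 0) p (volume.restrict K) +
      scaleNorm f (unitTestMoments d r ⌊α⌋₊) α p q K < ∞}

/-- The complex-linear extension of a distribution to complex-valued test functions. -/
def complexApply {d : ℕ} (f : 𝓓'(whole d, ℂ)) (g : 𝓓(whole d, ℂ)) : ℂ :=
  f (TestFunction.postcompCLM (𝕜 := ℝ) Complex.reCLM g) +
    Complex.I * f (TestFunction.postcompCLM (𝕜 := ℝ) Complex.imCLM g)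

/-- The product of a test function and a Schwartz function, as a test function. -/
def mulSchwartz {d : ℕ} (φ : 𝓓(whole d, ℂ)) (g : 𝓢(EuclideanSpace ℝ (Fin d), ℂ)) :
    𝓓(whole d, ℂ) where
  toFun x := φ x * g x
  contDiff' := φ.contDiff.mul (g.smooth ⊤)
  hasCompactSupport' := φ.hasCompactSupport.mul_right
  tsupport_subset' := by simp [whole]

/-- The local Sobolev space `H^s_loc(ℝ^d)`: those distributions `f` such that for every test
function `φ` the product `φ f`, i.e. the tempered distribution `g ↦ f(φ g)`, lies in `H^s(ℝ^d)`. -/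
def sobolevLoc (d : ℕ) (s : ℝ) : Set 𝓓'(whole d, ℂ) :=
  {f | ∀ φ : 𝓓(whole d, ℂ), ∃ T : 𝓢'(EuclideanSpace ℝ (Fin d), ℂ),
    (∀ g : 𝓢(EuclideanSpace ℝ (Fin d), ℂ), T g = complexApply f (mulSchwartz φ g)) ∧
      TemperedDistribution.MemSobolev s 2 T}

end BesovSobolev

end

noncomputable section

namespace BesovSobolev

open Filter Topology Set LineDeriv FourierTransform
open scoped BoundedContinuousFunction ContDiff

variable {d : ℕ}

/-! Fix a cutoff `φ` and a mollifier `ρ` of integral one, and set `ψ = 2^d ρ(2·) - ρ`. The smooth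
functions `x ↦ f(ρ_x^{2^{-n}})` converge to `f` and telescope, so `φ f` is a smooth coarse term plus
the sum of the pieces `G_n(x) = φ(x) f(ψ_x^{2^{-n}})`. If `ψ` has enough vanishing moments, the
Besov norm controls the pieces: since `p ≥ 2` and `K` has finite measure, `4^{nσ} ‖G_n‖²_{L²}` is
summable, with `σ = α` when `q = 2` and any `σ < α` otherwise (`squareDecay_of_mem_besovLoc`,
`squareDecay_of_mem_besovLoc_of_lt`).

Summing the pieces in `H^σ` requires almost orthogonality. Differentiating `G_n` costs a factor
`2^n`, so `4^{n(σ-N)} ‖G_n‖²_{H^N}` is summable for every `N`. Conversely, `exists_mollifier` makes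
`ψ` a divergence of functions with the same vanishing moments, which gains a factor `2^{-n}` in
`H^{-1}`, so `4^{n(σ+1)} ‖G_n‖²_{H^{-1}}` is summable. Hence `G_n` is concentrated at frequencies
`|ξ| ~ 2^n`. For `-1 < σ < N` a weighted Cauchy–Schwarz inequality then bounds the pairing of `φ f`
with Fourier-weighted Schwartz functions (`tsum_lintegral_fourier_mul_le`), and Riesz representation
produces the `L²` function required by the definition of `H^σ` (`exists_integral_eq_of_enorm_le`).
-/

/-! ### Translates of a test function and smoothness of their pairing with a distribution -/

/-- The translate `y ↦ θ (y + z)` of a test function. -/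
def shift (z : EuclideanSpace ℝ (Fin d)) (θ : 𝓓(whole d, ℝ)) : 𝓓(whole d, ℝ) where
  toFun y := θ (y + z)
  contDiff' := θ.contDiff.comp (contDiff_id.add contDiff_const)
  hasCompactSupport' := θ.hasCompactSupport.comp_homeomorph (Homeomorph.addRight z)
  tsupport_subset' := by simp [whole]

@[simp] theorem shift_apply (z : EuclideanSpace ℝ (Fin d)) (θ : 𝓓(whole d, ℝ))
    (y : EuclideanSpace ℝ (Fin d)) : shift z θ y = θ (y + z) := rfl

@[simp] theorem rescale_apply (n : ℕ) (x : EuclideanSpace ℝ (Fin d)) (ψ : 𝓓(whole d, ℝ))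
    (y : EuclideanSpace ℝ (Fin d)) :
    rescale n x ψ y = ((2 : ℝ) ^ n) ^ d * ψ ((2 : ℝ) ^ n • (x - y)) := rfl

theorem rescale_eq_shift (n : ℕ) (x : EuclideanSpace ℝ (Fin d)) (ψ : 𝓓(whole d, ℝ)) :
    rescale n x ψ = shift (-x) (rescale n 0 ψ) := by
  ext y
  simp only [rescale_apply, shift_apply]
  congr 3
  abel

theorem lineDerivOp_testFunction_apply {F : Type*} [NormedAddCommGroup F] [NormedSpace ℝ F]
    (v : EuclideanSpace ℝ (Fin d)) (θ : 𝓓(whole d, F)) (x : EuclideanSpace ℝ (Fin d)) :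
    (∂_{v} θ) x = fderiv ℝ θ x v := by
  change TestFunction.fderivCLM ℝ ⊤ ⊤ θ x v = _
  rw [TestFunction.fderivCLM_apply_of_le _ (by simp)]

/-- On functions supported in `K` the topology comes from the seminorms of the individual
derivatives, so continuity involves only finitely many of them: a distribution has finite order on a
compact set. -/
theorem exists_bound_of_isCompact (f : 𝓓'(whole d, ℂ)) {K : Set (EuclideanSpace ℝ (Fin d))}
    (hK : IsCompact K) : ∃ (N : ℕ) (C : ℝ), 0 ≤ C ∧ ∀ ψ : 𝓓(whole d, ℝ), tsupport ψ ⊆ K →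
      ∀ M : ℝ, 0 ≤ M → (∀ i ≤ N, ∀ x, ‖iteratedFDeriv ℝ i ψ x‖ ≤ M) → ‖f ψ‖ ≤ C * M := by
  set K' : TopologicalSpace.Compacts (EuclideanSpace ℝ (Fin d)) := ⟨K, hK⟩
  have hKs : (K' : Set (EuclideanSpace ℝ (Fin d))) ⊆ (whole d : Set (EuclideanSpace ℝ (Fin d))) := by
    simp [whole]
  have hc : Continuous (fun ψ : 𝓓_{K'}(EuclideanSpace ℝ (Fin d), ℝ) =>
      f (TestFunction.ofSupportedIn hKs ψ)) :=
    f.continuous.comp (TestFunction.continuous_ofSupportedIn hKs)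
  let lin : 𝓓_{K'}(EuclideanSpace ℝ (Fin d), ℝ) →ₗ[ℝ] ℂ :=
    { toFun := fun ψ => f (TestFunction.ofSupportedIn hKs ψ)
      map_add' := fun a b => map_add f (TestFunction.ofSupportedIn hKs a)
        (TestFunction.ofSupportedIn hKs b)
      map_smul' := fun a b => map_smul f a (TestFunction.ofSupportedIn hKs b) }
  let q : Seminorm ℝ 𝓓_{K'}(EuclideanSpace ℝ (Fin d), ℝ) := (normSeminorm ℝ ℂ).comp lin
  have hq : Continuous q := hc.norm
  obtain ⟨s, C, hC, hb⟩ := Seminorm.bound_of_continuous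
    (ContDiffMapSupportedIn.withSeminorms ℝ _ ℝ ⊤ K') q hq
  refine ⟨s.sup id, C, C.2, fun ψ hψ M hM hD => ?_⟩
  have hsupp : Function.support ψ ⊆ K' := (subset_tsupport ψ).trans hψ
  let ψ' : 𝓓_{K'}(EuclideanSpace ℝ (Fin d), ℝ) :=
    ContDiffMapSupportedIn.of_support_subset ψ.contDiff hsupp
  have h1 := hb ψ'
  have h2 : q ψ' = ‖f ψ‖ := rfl
  rw [h2] at h1
  refine h1.trans ?_
  change (C : ℝ) * _ ≤ _
  refine mul_le_mul_of_nonneg_left ?_ C.2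
  refine Seminorm.finset_sup_apply_le hM fun i hi => ?_
  rw [ContDiffMapSupportedIn.seminorm_top_le_iff _ hM]
  intro x _
  exact hD i (Finset.le_sup (f := id) hi) x

/-- Symmetry of second derivatives moves the direction `v` past one derivative at a time.
Consequently the derivatives of a first-order Taylor remainder are again Taylor remainders. -/
theorem fderiv_iteratedFDeriv_apply {E F : Type*} [NormedAddCommGroup E] [NormedSpace ℝ E]
    [NormedAddCommGroup F] [NormedSpace ℝ F] {g : E → F} (hg : ContDiff ℝ ∞ g) (v : E) (i : ℕ) :
    ∀ y, fderiv ℝ (iteratedFDeriv ℝ i g) y v = iteratedFDeriv ℝ i (fun z => fderiv ℝ g z v) y := by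
  have happ : ∀ (k : ℕ) (y : E) (m : Fin k → E), fderiv ℝ (iteratedFDeriv ℝ k g) y v m =
      fderiv ℝ (fun z => iteratedFDeriv ℝ k g z m) y v := by
    intro k y m
    have hs : ContDiff ℝ ∞ (iteratedFDeriv ℝ k g) := hg.iteratedFDeriv_right (mod_cast le_top)
    have h := ((ContinuousMultilinearMap.apply ℝ (fun _ : Fin k => E) F m).hasFDerivAt.comp y
      (hs.differentiable (by simp) y).hasFDerivAt).fderiv
    exact (congrArg (fun T => T v) h).symm
  induction i with
  | zero =>
    intro y
    ext m
    rw [happ]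
    simp
  | succ i ih =>
    intro y
    have hs : ContDiff ℝ ∞ (iteratedFDeriv ℝ i g) := hg.iteratedFDeriv_right (mod_cast le_top)
    have h0 : iteratedFDeriv ℝ i (fun z => fderiv ℝ g z v) =
      fun y => fderiv ℝ (iteratedFDeriv ℝ i g) y v := by
      funext y; exact (ih y).symm
    have h1 : DifferentiableAt ℝ (fderiv ℝ (iteratedFDeriv ℝ i g)) y :=
      ((hs.fderiv_right (m := ∞) (by simp)).differentiable (by simp)) y
    have h2 : ∀ v w, fderiv ℝ (fun y => fderiv ℝ (iteratedFDeriv ℝ i g) y v) y w =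
        fderiv ℝ (fderiv ℝ (iteratedFDeriv ℝ i g)) y w v := by
      intro v w
      rw [fderiv_clm_apply h1 (by fun_prop)]
      simp
    ext m
    rw [happ]
    simp_rw [iteratedFDeriv_succ_apply_left]
    rw [h0, h2, ← ((hs.contDiffAt (x := y)).isSymmSndFDerivAt (by simp; exact WithTop.coe_le_coe.2 (le_top : (2 : ℕ∞) ≤ ⊤))) v (m 0), ← h2]
    have h3 : DifferentiableAt ℝ (fun y => fderiv ℝ (iteratedFDeriv ℝ i g) y (m 0)) y := by
      fun_prop
    have h := ((ContinuousMultilinearMap.apply ℝ (fun _ : Fin i => E) F (Fin.tail m)).hasFDerivAt.comp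
      y h3.hasFDerivAt).fderiv
    exact congrArg (fun T => T v) h

/-- Compact support makes `fderiv ℝ h` globally Lipschitz, and the mean value inequality then bounds
the Taylor remainder uniformly in the base point. -/
theorem exists_bound_sub_sub_fderiv {E F : Type*} [NormedAddCommGroup E] [NormedSpace ℝ E]
    [NormedAddCommGroup F] [NormedSpace ℝ F] {h : E → F} (hh : ContDiff ℝ ∞ h)
    (hc : HasCompactSupport h) :
    ∃ M : ℝ, 0 ≤ M ∧ ∀ z v, ‖h (z + v) - h z - fderiv ℝ h z v‖ ≤ M * ‖v‖ ^ 2 := by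
  obtain ⟨M, hM⟩ := ContDiff.lipschitzWith_of_hasCompactSupport (hc.fderiv ℝ)
    (hh.fderiv_right (m := ∞) (by simp)) (by simp)
  refine ⟨M, M.2, fun z v => ?_⟩
  have h1 : ∀ z' ∈ Metric.closedBall z ‖v‖, ‖fderiv ℝ h z' - fderiv ℝ h z‖ ≤ M * ‖v‖ := by
    intro z' hz'
    rw [← dist_eq_norm]
    refine (hM.dist_le_mul z' z).trans ?_
    gcongr
    simpa [dist_eq_norm] using hz'
  have h2 := Convex.norm_image_sub_le_of_norm_hasFDerivWithin_le'
    (f := h) (f' := fderiv ℝ h) (φ := fderiv ℝ h z) (s := Metric.closedBall z ‖v‖)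
    (fun x _ => (hh.differentiable (by simp) x).hasFDerivAt.hasFDerivWithinAt) h1
    (convex_closedBall _ _) (x := z) (y := z + v) (by simp) (by simp)
  simpa [pow_two, mul_assoc] using h2

theorem shift_add (x : EuclideanSpace ℝ (Fin d)) (θ η : 𝓓(whole d, ℝ)) :
    shift x (θ + η) = shift x θ + shift x η := rfl

theorem shift_smul (x : EuclideanSpace ℝ (Fin d)) (c : ℝ) (θ : 𝓓(whole d, ℝ)) :
    shift x (c • θ) = c • shift x θ := rfl

/-- The derivative of `x ↦ f (shift x θ)`. -/
def shiftDeriv (f : 𝓓'(whole d, ℂ)) (θ : 𝓓(whole d, ℝ)) (x : EuclideanSpace ℝ (Fin d)) :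
    EuclideanSpace ℝ (Fin d) →L[ℝ] ℂ :=
  LinearMap.toContinuousLinearMap
    { toFun := fun v => f (shift x (∂_{v} θ))
      map_add' := fun v w => by rw [lineDerivOp_left_add, shift_add, map_add]
      map_smul' := fun c v => by
        rw [lineDerivOp_left_smul, shift_smul, map_smul, RingHom.id_apply] }

theorem shiftDeriv_apply (f : 𝓓'(whole d, ℂ)) (θ : 𝓓(whole d, ℝ))
    (x v : EuclideanSpace ℝ (Fin d)) : shiftDeriv f θ x v = f (shift x (∂_{v} θ)) := rfl

theorem exists_tsupport_subset_closedBall {F : Type*} [NormedAddCommGroup F]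
    {g : EuclideanSpace ℝ (Fin d) → F} (hg : HasCompactSupport g) :
    ∃ R : ℝ, 0 ≤ R ∧ tsupport g ⊆ Metric.closedBall 0 R := by
  obtain ⟨R, hR⟩ := hg.isBounded.subset_closedBall 0
  exact ⟨max R 0, le_max_right _ _, hR.trans (Metric.closedBall_subset_closedBall (le_max_left _ _))⟩

theorem contDiff_iteratedFDeriv_testFunction (θ : 𝓓(whole d, ℝ)) (i : ℕ) :
    ContDiff ℝ ∞ (iteratedFDeriv ℝ i θ) :=
  θ.contDiff.iteratedFDeriv_right (mod_cast le_top)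

theorem iteratedFDeriv_shift (θ : 𝓓(whole d, ℝ)) (i : ℕ) (x y : EuclideanSpace ℝ (Fin d)) :
    iteratedFDeriv ℝ i (shift x θ) y = iteratedFDeriv ℝ i θ (y + x) :=
  congrFun (iteratedFDeriv_comp_add_right' i x) y

/-- The Taylor remainder of `v ↦ shift (x + v) θ` is itself a test function, all of whose
derivatives up to the order of `f` are `O(‖v‖²)`; applying `f` keeps this bound. -/
theorem hasFDerivAt_apply_shift (f : 𝓓'(whole d, ℂ)) (θ : 𝓓(whole d, ℝ))
    (x : EuclideanSpace ℝ (Fin d)) :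
    HasFDerivAt (fun x => f (shift x θ)) (shiftDeriv f θ x) x := by
  obtain ⟨R, hR0, hR⟩ := exists_tsupport_subset_closedBall θ.hasCompactSupport
  -- The extra `1` in the radius leaves room for every increment `v` with `‖v‖ ≤ 1`, so one compact
  -- set and one order serve for all of them.
  obtain ⟨N, C, hC, hb⟩ := exists_bound_of_isCompact f
    (isCompact_closedBall (0 : EuclideanSpace ℝ (Fin d)) (R + ‖x‖ + 1))
  choose M hM0 hM using fun i => exists_bound_sub_sub_fderiv
    (contDiff_iteratedFDeriv_testFunction θ i) (θ.hasCompactSupport.iteratedFDeriv i)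
  have hMs : 0 ≤ ∑ i ∈ Finset.range (N + 1), M i := Finset.sum_nonneg fun i _ => hM0 i
  rw [hasFDerivAt_iff_isLittleO_nhds_zero]
  refine Asymptotics.IsBigO.trans_isLittleO ?_ (Asymptotics.isLittleO_norm_pow_id one_lt_two)
  refine Asymptotics.IsBigO.of_bound (C * ∑ i ∈ Finset.range (N + 1), M i) ?_
  filter_upwards [Metric.ball_mem_nhds (0 : EuclideanSpace ℝ (Fin d)) one_pos] with v hv
  have hv1 : ‖v‖ ≤ 1 := by simpa using (mem_ball_zero_iff.1 hv).le
  rw [shiftDeriv_apply, ← map_sub, ← map_sub]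
  refine (hb _ ?_ ((∑ i ∈ Finset.range (N + 1), M i) * ‖v‖ ^ 2) (by positivity) ?_).trans
    (by rw [norm_pow, norm_norm, mul_assoc])
  · refine closure_minimal ?_ Metric.isClosed_closedBall
    intro y hy
    have hz : ∀ z : EuclideanSpace ℝ (Fin d), ‖z‖ ≤ ‖x‖ + 1 → y + z ∈ tsupport θ →
        y ∈ Metric.closedBall 0 (R + ‖x‖ + 1) := by
      intro z hz hyz
      have h1 := hR hyz
      rw [mem_closedBall_zero_iff] at h1 ⊢
      have := norm_sub_le (y + z) z
      rw [add_sub_cancel_right] at this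
      linarith
    by_contra hcon
    apply hy
    have e1 : y + (x + v) ∉ tsupport θ := fun h =>
      hcon (hz _ ((norm_add_le _ _).trans (by linarith)) h)
    have e2 : y + x ∉ tsupport θ := fun h => hcon (hz _ (by linarith) h)
    change θ (y + (x + v)) - θ (y + x) - (∂_{v} θ) (y + x) = 0
    rw [lineDerivOp_testFunction_apply, image_eq_zero_of_notMem_tsupport e1,
      image_eq_zero_of_notMem_tsupport e2, fderiv_of_notMem_tsupport (𝕜 := ℝ) e2]
    simp
  · intro i hi y
    have e : iteratedFDeriv ℝ i (shift (x + v) θ - shift x θ - shift x (∂_{v} θ) :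
        𝓓(whole d, ℝ)) y = iteratedFDeriv ℝ i θ (y + x + v) - iteratedFDeriv ℝ i θ (y + x) -
          fderiv ℝ (iteratedFDeriv ℝ i θ) (y + x) v := by
      have c : ∀ η : 𝓓(whole d, ℝ), ContDiffAt ℝ i η y := fun η =>
        (η.contDiff.of_le (mod_cast le_top)).contDiffAt
      have e1 : (⇑(shift (x + v) θ - shift x θ - shift x (∂_{v} θ)) :
        EuclideanSpace ℝ (Fin d) → ℝ) =
          (⇑(shift (x + v) θ) - ⇑(shift x θ)) - ⇑(shift x (∂_{v} θ)) := rfl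
      have c12 : ContDiffAt ℝ i (⇑(shift (x + v) θ) - ⇑(shift x θ)) y := (c _).sub (c _)
      rw [e1, iteratedFDeriv_sub_apply c12 (c _),
        iteratedFDeriv_sub_apply (c _) (c _)]
      rw [iteratedFDeriv_shift, iteratedFDeriv_shift, iteratedFDeriv_shift,
        fderiv_iteratedFDeriv_apply θ.contDiff, add_assoc]
      congr 2
    rw [e]
    refine (hM i _ _).trans ?_
    gcongr
    exact Finset.single_le_sum (f := M) (fun i _ => hM0 i) (Finset.mem_range.2 (by omega))

/-- A directional derivative is a function of the same kind with `∂_{v} θ` in place of `θ`, so the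
induction runs over all `θ` at once. -/
theorem contDiff_apply_shift (f : 𝓓'(whole d, ℂ)) (θ : 𝓓(whole d, ℝ)) :
    ContDiff ℝ ∞ (fun x => f (shift x θ)) := by
  rw [contDiff_infty]
  intro n
  induction n generalizing θ with
  | zero =>
    exact contDiff_zero.2 (continuous_iff_continuousAt.2 fun x =>
      (hasFDerivAt_apply_shift f θ x).continuousAt)
  | succ n ih =>
    rw [Nat.cast_add, Nat.cast_one, contDiff_succ_iff_fderiv_apply]
    refine ⟨fun x => (hasFDerivAt_apply_shift f θ x).differentiableAt, by simp, fun v => ?_⟩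
    simp_rw [(hasFDerivAt_apply_shift f θ _).fderiv, shiftDeriv_apply]
    exact ih _

theorem continuous_apply_shift (f : 𝓓'(whole d, ℂ)) (θ : 𝓓(whole d, ℝ)) :
    Continuous (fun x => f (shift x θ)) := (contDiff_apply_shift f θ).continuous

theorem contDiff_apply_rescale (f : 𝓓'(whole d, ℂ)) (n : ℕ) (ψ : 𝓓(whole d, ℝ)) :
    ContDiff ℝ ∞ (fun x => f (rescale n x ψ)) := by
  have h : (fun x => f (rescale n x ψ)) = fun x => f (shift (-x) (rescale n 0 ψ)) :=
    funext fun x => by rw [rescale_eq_shift]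
  rw [h]
  exact (contDiff_apply_shift f _).comp contDiff_neg

theorem lineDerivOp_rescale_zero (n : ℕ) (ψ : 𝓓(whole d, ℝ)) (v : EuclideanSpace ℝ (Fin d)) :
    ∂_{v} (rescale n 0 ψ) = -((2 : ℝ) ^ n • rescale n 0 (∂_{v} ψ)) := by
  ext y
  rw [lineDerivOp_testFunction_apply]
  change _ = -((2 : ℝ) ^ n * rescale n 0 (∂_{v} ψ) y)
  rw [rescale_apply, lineDerivOp_testFunction_apply]
  have h : HasFDerivAt (fun y => ((2 : ℝ) ^ n) ^ d * ψ ((2 : ℝ) ^ n • (0 - y)))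
      (((2 : ℝ) ^ n) ^ d • (fderiv ℝ ψ ((2 : ℝ) ^ n • (0 - y))).comp
        ((2 : ℝ) ^ n • (-ContinuousLinearMap.id ℝ _))) y := by
    refine HasFDerivAt.const_mul ?_ _
    refine HasFDerivAt.comp y ((ψ.contDiff.differentiable (by simp)) _).hasFDerivAt ?_
    exact ((hasFDerivAt_id y).const_sub 0).const_smul ((2 : ℝ) ^ n)
  have e : (rescale n 0 ψ : EuclideanSpace ℝ (Fin d) → ℝ) =
    fun y => ((2 : ℝ) ^ n) ^ d * ψ ((2 : ℝ) ^ n • (0 - y)) := rfl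
  rw [e, h.fderiv]
  simp
  ring

/-- Each derivative in `x` costs `2^n` and falls on `ψ`. The signs from the reflection inside
`rescale` and from the shift by `-x` cancel. -/
theorem fderiv_apply_rescale (f : 𝓓'(whole d, ℂ)) (n : ℕ) (ψ : 𝓓(whole d, ℝ))
    (x v : EuclideanSpace ℝ (Fin d)) :
    fderiv ℝ (fun x => f (rescale n x ψ)) x v = 2 ^ n * f (rescale n x (∂_{v} ψ)) := by
  have e : (fun x => f (rescale n x ψ)) = fun x => f (shift (-x) (rescale n 0 ψ)) :=
    funext fun x => by rw [rescale_eq_shift]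
  rw [e]
  have h : HasFDerivAt (fun x => f (shift (-x) (rescale n 0 ψ))) _ x :=
    (hasFDerivAt_apply_shift f (rescale n 0 ψ) (-x)).comp x (hasFDerivAt_id x).neg
  rw [h.fderiv]
  simp only [ContinuousLinearMap.comp_apply, neg_apply,
    ContinuousLinearMap.id_apply, map_neg, shiftDeriv_apply, lineDerivOp_rescale_zero]
  rw [rescale_eq_shift n x, ← smul_neg, shift_smul, map_smul]
  have : shift (-x) (-rescale n 0 (∂_{v} ψ)) = -shift (-x) (rescale n 0 (∂_{v} ψ)) := rfl
  rw [this, map_neg]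
  simp [Complex.real_smul]

/-! ### Averages of translates and exchanging a distribution with an integral -/

section Averages

variable {F : Type*} [NormedAddCommGroup F] [NormedSpace ℝ F]

theorem integrable_smul_translate {w : EuclideanSpace ℝ (Fin d) → ℝ} (hw : Continuous w)
    (hwc : HasCompactSupport w) {g : EuclideanSpace ℝ (Fin d) → F} (hg : Continuous g)
    (y : EuclideanSpace ℝ (Fin d)) : Integrable (fun z => w z • g (y + z)) :=
  (hw.smul (hg.comp (continuous_const.add continuous_id))).integrable_of_hasCompactSupport
    hwc.smul_right

theorem hasFDerivAt_integral_smul_translate {w : EuclideanSpace ℝ (Fin d) → ℝ} (hw : Continuous w)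
    (hwc : HasCompactSupport w) {g : EuclideanSpace ℝ (Fin d) → F} (hg : ContDiff ℝ ∞ g)
    (hgc : HasCompactSupport g) (y : EuclideanSpace ℝ (Fin d)) :
    HasFDerivAt (fun y => ∫ z, w z • g (y + z)) (∫ z, w z • fderiv ℝ g (y + z)) y := by
  have hg' : Continuous (fderiv ℝ g) := hg.continuous_fderiv (by simp)
  obtain ⟨C, hC⟩ := hg'.bounded_above_of_compact_support (hgc.fderiv ℝ)
  refine hasFDerivAt_integral_of_dominated_of_fderiv_le (s := univ) (bound := fun z => ‖w z‖ * C)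
    (F' := fun y z => w z • fderiv ℝ g (y + z)) univ_mem
    (Eventually.of_forall fun y => (integrable_smul_translate hw hwc hg.continuous y).1)
    (integrable_smul_translate hw hwc hg.continuous y)
    (integrable_smul_translate hw hwc hg' y).1
    (Eventually.of_forall fun z y _ => ?_)
    ((hw.norm.integrable_of_hasCompactSupport hwc.norm).mul_const C)
    (Eventually.of_forall fun z y _ => ?_)
  · rw [norm_smul]
    gcongr
    exact hC _
  · have h := (hg.differentiable (by simp) (y + z)).hasFDerivAt.comp y
      ((hasFDerivAt_id y).add_const z)
    exact h.const_smul (w z)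

theorem iteratedFDeriv_integral_smul_translate [CompleteSpace F]
    {w : EuclideanSpace ℝ (Fin d) → ℝ} (hw : Continuous w)
    (hwc : HasCompactSupport w) {g : EuclideanSpace ℝ (Fin d) → F} (hg : ContDiff ℝ ∞ g)
    (hgc : HasCompactSupport g) (i : ℕ) :
    iteratedFDeriv ℝ i (fun y => ∫ z, w z • g (y + z)) =
      fun y => ∫ z, w z • iteratedFDeriv ℝ i g (y + z) := by
  have hs : ∀ i : ℕ, ContDiff ℝ ∞ (iteratedFDeriv ℝ i g) :=
    fun i => hg.iteratedFDeriv_right (mod_cast le_top)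
  have key : ∀ (i : ℕ) (y : EuclideanSpace ℝ (Fin d)) (m : Fin i → EuclideanSpace ℝ (Fin d)),
      (∫ z, w z • iteratedFDeriv ℝ i g (y + z)) m =
        ∫ z, w z • iteratedFDeriv ℝ i g (y + z) m := by
    intro i y m
    exact ((ContinuousMultilinearMap.apply ℝ (fun _ : Fin i => EuclideanSpace ℝ (Fin d)) F
      m).integral_comp_comm (integrable_smul_translate hw hwc (hs i).continuous y)).symm
  induction i with
  | zero =>
    funext y
    ext m
    rw [key]
    simp
  | succ i ih =>
    funext y
    ext m
    rw [key, iteratedFDeriv_succ_apply_left, ih,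
      (hasFDerivAt_integral_smul_translate hw hwc (hs i) (hgc.iteratedFDeriv i) y).fderiv,
      ContinuousLinearMap.integral_apply
        (integrable_smul_translate hw hwc ((hs i).continuous_fderiv (by simp)) y)]
    have h1 : Integrable (fun z => (w z • fderiv ℝ (iteratedFDeriv ℝ i g) (y + z)) (m 0)) :=
      (integrable_smul_translate hw hwc ((hs i).continuous_fderiv (by simp))
        y).apply_continuousLinearMap _
    exact ((ContinuousMultilinearMap.apply ℝ (fun _ : Fin i => EuclideanSpace ℝ (Fin d)) F
      (Fin.tail m)).integral_comp_comm h1).symm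

theorem contDiff_integral_smul_translate [CompleteSpace F]
    {w : EuclideanSpace ℝ (Fin d) → ℝ} (hw : Continuous w)
    (hwc : HasCompactSupport w) {g : EuclideanSpace ℝ (Fin d) → F} (hg : ContDiff ℝ ∞ g)
    (hgc : HasCompactSupport g) : ContDiff ℝ ∞ (fun y => ∫ z, w z • g (y + z)) := by
  refine contDiff_of_differentiable_iteratedFDeriv fun m _ => ?_
  rw [iteratedFDeriv_integral_smul_translate hw hwc hg hgc]
  exact fun y => (hasFDerivAt_integral_smul_translate hw hwc
    (hg.iteratedFDeriv_right (mod_cast le_top)) (hgc.iteratedFDeriv m) y).differentiableAt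

end Averages

/-- The `i`-th derivative of a test function, as a bounded continuous function. -/
def jet (i : ℕ) (θ : 𝓓(whole d, ℝ)) :
    EuclideanSpace ℝ (Fin d) →ᵇ (EuclideanSpace ℝ (Fin d) [×i]→L[ℝ] ℝ) :=
  BoundedContinuousFunction.ofNormedAddCommGroup (iteratedFDeriv ℝ i θ)
    (contDiff_iteratedFDeriv_testFunction θ i).continuous _
    (((contDiff_iteratedFDeriv_testFunction θ i).continuous.bounded_above_of_compact_support
      (θ.hasCompactSupport.iteratedFDeriv i)).choose_spec)

@[simp] theorem jet_apply (i : ℕ) (θ : 𝓓(whole d, ℝ)) (y : EuclideanSpace ℝ (Fin d)) :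
    jet i θ y = iteratedFDeriv ℝ i θ y := rfl

/-- Families of bounded continuous functions taking values in `i`-linear maps, `i ≤ N`. -/
def JetSpace (d N : ℕ) : Type :=
  (i : Fin (N + 1)) → EuclideanSpace ℝ (Fin d) →ᵇ (EuclideanSpace ℝ (Fin d) [×(i : ℕ)]→L[ℝ] ℝ)

instance (N : ℕ) : NormedAddCommGroup (JetSpace d N) :=
  inferInstanceAs (NormedAddCommGroup ((i : Fin (N + 1)) →
    EuclideanSpace ℝ (Fin d) →ᵇ (EuclideanSpace ℝ (Fin d) [×(i : ℕ)]→L[ℝ] ℝ)))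

instance (N : ℕ) : NormedSpace ℝ (JetSpace d N) :=
  inferInstanceAs (NormedSpace ℝ ((i : Fin (N + 1)) →
    EuclideanSpace ℝ (Fin d) →ᵇ (EuclideanSpace ℝ (Fin d) [×(i : ℕ)]→L[ℝ] ℝ)))

instance (N : ℕ) : CompleteSpace (JetSpace d N) :=
  inferInstanceAs (CompleteSpace ((i : Fin (N + 1)) →
    EuclideanSpace ℝ (Fin d) →ᵇ (EuclideanSpace ℝ (Fin d) [×(i : ℕ)]→L[ℝ] ℝ)))

/-- The derivatives of order at most `N` of a test function. -/
def jets (N : ℕ) (θ : 𝓓(whole d, ℝ)) : JetSpace d N := fun i => jet i θ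

/-- Evaluation of the `i`-th component at a point. -/
def JetSpace.eval {N : ℕ} (i : Fin (N + 1)) (y : EuclideanSpace ℝ (Fin d)) :
    JetSpace d N →L[ℝ] (EuclideanSpace ℝ (Fin d) [×(i : ℕ)]→L[ℝ] ℝ) :=
  LinearMap.mkContinuous
    { toFun := fun u => u i y
      map_add' := fun _ _ => rfl
      map_smul' := fun _ _ => rfl } 1 (fun u => by
        rw [one_mul]
        exact ((u i).norm_coe_le_norm y).trans (norm_le_pi_norm u i))

theorem JetSpace.ext {N : ℕ} {u v : JetSpace d N} (h : ∀ i y, eval i y u = eval i y v) : u = v :=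
  funext fun i => BoundedContinuousFunction.ext fun y => h i y

theorem JetSpace.eval_jets {N : ℕ} (i : Fin (N + 1)) (y : EuclideanSpace ℝ (Fin d))
    (θ : 𝓓(whole d, ℝ)) : eval i y (jets N θ) = iteratedFDeriv ℝ i θ y := rfl

/-- The finite-order bound says that `f` is bounded for the norm of a Banach space of jets, and
Hahn–Banach extends it there. Bochner integrals can then be taken in that space and commuted with
`G`. -/
theorem exists_factor_through_jets (f : 𝓓'(whole d, ℂ)) {K : Set (EuclideanSpace ℝ (Fin d))}
    (hK : IsCompact K) : ∃ (N : ℕ) (G : JetSpace d N →L[ℝ] ℂ),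
      ∀ ψ : 𝓓(whole d, ℝ), tsupport ψ ⊆ K → f ψ = G (jets N ψ) := by
  obtain ⟨N, C, hC, hb⟩ := exists_bound_of_isCompact f hK
  refine ⟨N, ?_⟩
  set K' : TopologicalSpace.Compacts (EuclideanSpace ℝ (Fin d)) := ⟨K, hK⟩
  have hKs : (K' : Set (EuclideanSpace ℝ (Fin d))) ⊆
      (whole d : Set (EuclideanSpace ℝ (Fin d))) := by simp [whole]
  let lin : 𝓓_{K'}(EuclideanSpace ℝ (Fin d), ℝ) →ₗ[ℝ] ℂ :=
    { toFun := fun ψ => f (TestFunction.ofSupportedIn hKs ψ)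
      map_add' := fun a b => map_add f (TestFunction.ofSupportedIn hKs a)
        (TestFunction.ofSupportedIn hKs b)
      map_smul' := fun a b => map_smul f a (TestFunction.ofSupportedIn hKs b) }
  let ι : 𝓓_{K'}(EuclideanSpace ℝ (Fin d), ℝ) →ₗ[ℝ] JetSpace d N :=
    { toFun := fun ψ i => ContDiffMapSupportedIn.structureMapLM ℝ ⊤ (i : ℕ) ψ
      map_add' := fun a b => funext fun i =>
        (ContDiffMapSupportedIn.structureMapLM ℝ ⊤ (i : ℕ)).map_add a b
      map_smul' := fun a b => funext fun i =>
        (ContDiffMapSupportedIn.structureMapLM ℝ ⊤ (i : ℕ)).map_smul a b }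
  have hι : ∀ ψ i x, JetSpace.eval i x (ι ψ) = iteratedFDeriv ℝ i ψ x := by
    intro ψ i x
    exact congrFun (ContDiffMapSupportedIn.structureMapLM_top_apply ℝ ψ) x
  -- The order-zero component recovers the function, so `f` induces a well-defined functional on the
  -- range of `ι`.
  have hinj : Function.Injective ι := by
    intro a b hab
    ext x
    have h := hι a 0 x
    rw [hab, hι] at h
    have h2 := congrArg (fun m => m ![]) h
    exact h2.symm
  have hbound : ∀ ψ, ‖lin ψ‖ ≤ C * ‖ι ψ‖ := by
    intro ψ
    refine hb (TestFunction.ofSupportedIn hKs ψ) ψ.tsupport_subset _ (norm_nonneg _) ?_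
    intro i hi x
    have h1 := (ι ψ ⟨i, by omega⟩).norm_coe_le_norm x
    change ‖JetSpace.eval ⟨i, by omega⟩ x (ι ψ)‖ ≤ _ at h1
    rw [hι] at h1
    exact h1.trans (norm_le_pi_norm (ι ψ) _)
  let e := LinearEquiv.ofInjective ι hinj
  let g : LinearMap.range ι →L[ℝ] ℂ := (lin ∘ₗ e.symm.toLinearMap).mkContinuous C (by
    intro v
    obtain ⟨ψ, rfl⟩ := e.surjective v
    change ‖lin (e.symm (e ψ))‖ ≤ C * ‖ι ψ‖
    rw [e.symm_apply_apply]
    exact hbound ψ)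
  obtain ⟨G, hG⟩ := g.exist_extension_of_finiteDimensional_range
  refine ⟨G, fun ψ hψ => ?_⟩
  have hsupp : Function.support ψ ⊆ K' := (subset_tsupport ψ).trans hψ
  let ψ' : 𝓓_{K'}(EuclideanSpace ℝ (Fin d), ℝ) :=
    ContDiffMapSupportedIn.of_support_subset ψ.contDiff hsupp
  have h1 : f ψ = g (e ψ') := by
    change f ψ = lin (e.symm (e ψ'))
    rw [e.symm_apply_apply]
    rfl
  rw [h1, hG]
  change G (ι ψ') = _
  congr 1

theorem continuous_jet_shift (i : ℕ) (θ : 𝓓(whole d, ℝ)) :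
    Continuous (fun z => jet i (shift z θ)) := by
  obtain ⟨C, hC⟩ := ContDiff.lipschitzWith_of_hasCompactSupport
    (θ.hasCompactSupport.iteratedFDeriv (𝕜 := ℝ) i)
    (contDiff_iteratedFDeriv_testFunction θ i) (by simp)
  refine LipschitzWith.continuous (K := C) (LipschitzWith.of_dist_le_mul fun z z' => ?_)
  refine (BoundedContinuousFunction.dist_le (by positivity)).2 fun y => ?_
  rw [jet_apply, jet_apply, iteratedFDeriv_shift, iteratedFDeriv_shift]
  simpa using hC.dist_le_mul (y + z) (y + z')

theorem continuous_jets_shift (N : ℕ) (θ : 𝓓(whole d, ℝ)) :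
    Continuous (fun z => jets N (shift z θ)) :=
  continuous_pi fun i => continuous_jet_shift i θ

/-- The test function `y ↦ ∫ w z * θ (y + z) dz`. -/
def average {w : EuclideanSpace ℝ (Fin d) → ℝ} (hw : Continuous w) (hwc : HasCompactSupport w)
    (θ : 𝓓(whole d, ℝ)) : 𝓓(whole d, ℝ) where
  toFun y := ∫ z, w z • θ (y + z)
  contDiff' := contDiff_integral_smul_translate hw hwc θ.contDiff θ.hasCompactSupport
  hasCompactSupport' := by
    obtain ⟨R, hR0, hR⟩ := exists_tsupport_subset_closedBall θ.hasCompactSupport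
    obtain ⟨S, hS0, hS⟩ := exists_tsupport_subset_closedBall hwc
    refine HasCompactSupport.intro (isCompact_closedBall 0 (R + S)) fun y hy => ?_
    refine integral_eq_zero_of_ae (Eventually.of_forall fun z => ?_)
    by_contra h
    simp only [Pi.zero_apply, smul_eq_mul, mul_eq_zero, not_or] at h
    have h1 := hS (subset_tsupport _ (Function.mem_support.2 h.1))
    have h2 := hR (subset_tsupport _ (Function.mem_support.2 h.2))
    rw [mem_closedBall_zero_iff] at h1 h2
    apply hy
    rw [mem_closedBall_zero_iff]
    have := norm_sub_le (y + z) z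
    rw [add_sub_cancel_right] at this
    linarith
  tsupport_subset' := by simp [whole]

theorem average_apply {w : EuclideanSpace ℝ (Fin d) → ℝ} (hw : Continuous w)
    (hwc : HasCompactSupport w) (θ : 𝓓(whole d, ℝ)) (y : EuclideanSpace ℝ (Fin d)) :
    average hw hwc θ y = ∫ z, w z • θ (y + z) := rfl

/-- The jets of an average are the Bochner integral of the jets of the translates, and a continuous
linear functional commutes with that integral. A single ball contains the support of the average and
of every translate with `w z ≠ 0`. -/
theorem apply_average (f : 𝓓'(whole d, ℂ)) {w : EuclideanSpace ℝ (Fin d) → ℝ} (hw : Continuous w)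
    (hwc : HasCompactSupport w) (θ : 𝓓(whole d, ℝ)) :
    f (average hw hwc θ) = ∫ z, w z • f (shift z θ) := by
  obtain ⟨R, hR0, hR⟩ := exists_tsupport_subset_closedBall θ.hasCompactSupport
  obtain ⟨S, hS0, hS⟩ := exists_tsupport_subset_closedBall hwc
  obtain ⟨T, hT0, hT⟩ := exists_tsupport_subset_closedBall (average hw hwc θ).hasCompactSupport
  obtain ⟨N, G, hG⟩ := exists_factor_through_jets f
    (isCompact_closedBall (0 : EuclideanSpace ℝ (Fin d)) (max (R + S) T))
  have hint : Integrable (fun z => w z • jets N (shift z θ)) :=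
    (hw.smul (continuous_jets_shift N θ)).integrable_of_hasCompactSupport hwc.smul_right
  have h1 : jets N (average hw hwc θ) = ∫ z, w z • jets N (shift z θ) := by
    refine JetSpace.ext fun i y => ?_
    rw [← (JetSpace.eval i y).integral_comp_comm hint, JetSpace.eval_jets]
    have h2 := congrFun (iteratedFDeriv_integral_smul_translate hw hwc θ.contDiff
      θ.hasCompactSupport i) y
    refine Eq.trans h2 ?_
    refine integral_congr_ae (Eventually.of_forall fun z => ?_)
    simp only [map_smul, JetSpace.eval_jets, iteratedFDeriv_shift]
  rw [hG _ (hT.trans (Metric.closedBall_subset_closedBall (le_max_right _ _))), h1,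
    ← G.integral_comp_comm hint]
  refine integral_congr_ae (Eventually.of_forall fun z => ?_)
  simp only [map_smul]
  by_cases hz : w z = 0
  · simp [hz]
  · rw [hG]
    refine closure_minimal ?_ Metric.isClosed_closedBall
    intro y hy
    have h1 := hS (subset_tsupport _ (Function.mem_support.2 hz))
    have h2 := hR (subset_tsupport _ (Function.mem_support.2 hy))
    rw [mem_closedBall_zero_iff] at h1 h2 ⊢
    have := norm_sub_le (y + z) z
    rw [add_sub_cancel_right] at this
    exact le_trans (by linarith) (le_max_left _ _)

/-! ### Approximation of a distribution by its mollifications -/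

/-- Both sides are `f` applied to one convolution, written as an average of translates of the
rescaled `ρ` or of translates of `θ`. In the second form the scale enters only through a small shift
of `θ`. -/
theorem integral_smul_apply_rescale (f : 𝓓'(whole d, ℂ)) (θ ρ : 𝓓(whole d, ℝ)) (n : ℕ) :
    ∫ x, θ x • f (rescale n x ρ) = ∫ z, ρ z • f (shift (((2 : ℝ) ^ n)⁻¹ • z) θ) := by
  have h2 : (2 : ℝ) ^ n ≠ 0 := by positivity
  have hθ : Continuous fun x => θ (-x) := θ.continuous.comp continuous_neg
  have hθc : HasCompactSupport fun x => θ (-x) :=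
    θ.hasCompactSupport.comp_homeomorph (Homeomorph.neg _)
  have hρ : Continuous fun x => rescale n 0 ρ (-x) := (rescale n 0 ρ).continuous.comp continuous_neg
  have hρc : HasCompactSupport fun x => rescale n 0 ρ (-x) :=
    (rescale n 0 ρ).hasCompactSupport.comp_homeomorph (Homeomorph.neg _)
  have e1 : ∫ x, θ x • f (rescale n x ρ) = ∫ x, θ (-x) • f (shift x (rescale n 0 ρ)) := by
    rw [← integral_neg_eq_self]
    refine integral_congr_ae (Eventually.of_forall fun z => ?_)
    simp only
    rw [rescale_eq_shift, neg_neg]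
  have e2 : average hθ hθc (rescale n 0 ρ) = average hρ hρc θ := by
    ext y
    rw [average_apply, average_apply, ← integral_neg_eq_self, ← integral_sub_right_eq_self _ (-y)]
    refine integral_congr_ae (Eventually.of_forall fun z => ?_)
    simp only [smul_eq_mul]
    rw [mul_comm]
    congr 2 <;> abel
  rw [e1, ← apply_average f hθ hθc, e2, apply_average]
  have e3 := Measure.integral_comp_smul (volume : Measure (EuclideanSpace ℝ (Fin d)))
    (fun z => ρ z • f (shift (((2 : ℝ) ^ n)⁻¹ • z) θ)) ((2 : ℝ) ^ n)
  rw [finrank_euclideanSpace_fin] at e3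
  have e4 : ∫ z, rescale n 0 ρ (-z) • f (shift z θ) =
      ∫ z, ((2 : ℝ) ^ n) ^ d • (ρ ((2 : ℝ) ^ n • z) •
        f (shift (((2 : ℝ) ^ n)⁻¹ • ((2 : ℝ) ^ n • z)) θ)) := by
    refine integral_congr_ae (Eventually.of_forall fun z => ?_)
    simp only [rescale_apply, sub_neg_eq_add, zero_add]
    rw [smul_smul _ _ z, inv_mul_cancel₀ h2, one_smul, mul_smul]
  rw [e4, integral_smul, e3, smul_smul, abs_of_pos (by positivity), mul_inv_cancel₀ (by positivity),
    one_smul]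

theorem tendsto_integral_smul_apply_rescale (f : 𝓓'(whole d, ℂ)) (θ ρ : 𝓓(whole d, ℝ))
    (hρ : ∫ x, ρ x = 1) :
    Tendsto (fun n : ℕ => ∫ x, θ x • f (rescale n x ρ)) atTop (𝓝 (f θ)) := by
  simp_rw [integral_smul_apply_rescale]
  have h0 : f θ = ∫ z, ρ z • f (shift 0 θ) := by
    rw [integral_smul_const, hρ, one_smul]
    congr 1
    ext y
    simp
  rw [h0]
  obtain ⟨R, hR0, hR⟩ := exists_tsupport_subset_closedBall ρ.hasCompactSupport
  obtain ⟨C, hC⟩ := (isCompact_closedBall (0 : EuclideanSpace ℝ (Fin d))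
    R).exists_bound_of_continuousOn (continuous_apply_shift f θ).continuousOn
  refine tendsto_integral_of_dominated_convergence (fun z => ‖ρ z‖ * C) (fun n => ?_) ?_ ?_ ?_
  · exact (ρ.continuous.smul ((continuous_apply_shift f θ).comp
      (continuous_const_smul _))).aestronglyMeasurable
  · exact (ρ.continuous.norm.integrable_of_hasCompactSupport ρ.hasCompactSupport.norm).mul_const C
  · refine fun n => Eventually.of_forall fun z => ?_
    rw [norm_smul]
    by_cases hz : ρ z = 0
    · simp [hz]
    · gcongr
      apply hC
      have h2 := hR (subset_tsupport _ (Function.mem_support.2 hz))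
      rw [mem_closedBall_zero_iff] at h2 ⊢
      rw [norm_smul, norm_inv, norm_pow, Real.norm_ofNat]
      have : ((2 : ℝ) ^ n)⁻¹ ≤ 1 := inv_le_one_of_one_le₀ (one_le_pow₀ one_le_two)
      calc _ ≤ 1 * ‖z‖ := by gcongr
        _ ≤ R := by linarith
  · refine Eventually.of_forall fun z => Tendsto.const_smul ?_ _
    have h1 : Tendsto (fun n : ℕ => ((2 : ℝ) ^ n)⁻¹ • z) atTop (𝓝 ((0 : ℝ) • z)) := by
      refine Tendsto.smul_const ?_ z
      exact tendsto_inv_atTop_zero.comp (tendsto_pow_atTop_atTop_of_one_lt one_lt_two)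
    rw [zero_smul] at h1
    exact ((continuous_apply_shift f θ).tendsto 0).comp h1

/-! ### Vanishing moments and the construction of the mollifier -/

theorem differentiable_prod_coord {a : Fin d → ℝ → ℝ} (ha : ∀ i, Differentiable ℝ (a i)) :
    Differentiable ℝ (fun x : EuclideanSpace ℝ (Fin d) => ∏ i, a i (x i)) := by
  intro x
  have h : ∀ i ∈ (Finset.univ : Finset (Fin d)),
      DifferentiableAt ℝ (fun x : EuclideanSpace ℝ (Fin d) => a i (x i)) x := fun i _ =>
    DifferentiableAt.comp x (ha i (x i)) (by fun_prop)
  exact (HasFDerivAt.finsetProd fun i hi => (h i hi).hasFDerivAt).differentiableAt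

theorem fderiv_prod_coord {a : Fin d → ℝ → ℝ} (ha : ∀ i, Differentiable ℝ (a i))
    (x : EuclideanSpace ℝ (Fin d)) (j : Fin d) :
    fderiv ℝ (fun x : EuclideanSpace ℝ (Fin d) => ∏ i, a i (x i)) x (EuclideanSpace.single j 1) =
      deriv (a j) (x j) * ∏ i ∈ Finset.univ.erase j, a i (x i) := by
  rw [← (differentiable_prod_coord ha x).lineDeriv_eq_fderiv]
  have h : (fun t : ℝ => ∏ i, a i ((x + t • EuclideanSpace.single j (1 : ℝ)) i)) =
      fun t => a j (x j + t) * ∏ i ∈ Finset.univ.erase j, a i (x i) := by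
    funext t
    rw [← Finset.mul_prod_erase _ _ (Finset.mem_univ j)]
    congr 1
    · simp
    · refine Finset.prod_congr rfl fun i hi => ?_
      have : i ≠ j := (Finset.mem_erase.1 hi).1
      simp [this]
  rw [lineDeriv, h, deriv_mul_const, deriv_comp_const_add, add_zero]
  exact ((ha j).comp (differentiable_id.const_add _)) 0

theorem contDiff_prod_coord {a : Fin d → ℝ → ℝ} (ha : ∀ i, ContDiff ℝ ∞ (a i)) :
    ContDiff ℝ ∞ (fun x : EuclideanSpace ℝ (Fin d) => ∏ i, a i (x i)) := by
  refine contDiff_prod fun i _ => (ha i).comp ?_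
  fun_prop

theorem continuous_monomial (k : Fin d → ℕ) :
    Continuous fun x : EuclideanSpace ℝ (Fin d) => ∏ i, x i ^ k i := by
  fun_prop

theorem integrable_monomial_mul (k : Fin d → ℕ) (ψ : 𝓓(whole d, ℝ)) :
    Integrable fun x : EuclideanSpace ℝ (Fin d) => (∏ i, x i ^ k i) * ψ x :=
  ((continuous_monomial k).mul ψ.continuous).integrable_of_hasCompactSupport
    ψ.hasCompactSupport.mul_left

/-- Test functions supported in the open unit ball, with vanishing moments up to order `m`. -/
def vanishing (d m : ℕ) : Submodule ℝ 𝓓(whole d, ℝ) where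
  carrier := {ψ | tsupport ψ ⊆ Metric.ball 0 1 ∧ ∀ k : Fin d → ℕ, ∑ i, k i ≤ m →
    ∫ x : EuclideanSpace ℝ (Fin d), (∏ i, x i ^ k i) * ψ x = 0}
  add_mem' := by
    rintro ψ η ⟨h1, h2⟩ ⟨h3, h4⟩
    refine ⟨(tsupport_add ψ η).trans (union_subset h1 h3), fun k hk => ?_⟩
    have : ∀ x, (∏ i, x i ^ k i) * (ψ + η) x = (∏ i, x i ^ k i) * ψ x + (∏ i, x i ^ k i) * η x :=
      fun x => mul_add _ _ _
    simp_rw [this]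
    rw [integral_add (integrable_monomial_mul k ψ) (integrable_monomial_mul k η), h2 k hk,
      h4 k hk, add_zero]
  zero_mem' := by
    refine ⟨?_, fun k _ => ?_⟩
    · change tsupport (0 : EuclideanSpace ℝ (Fin d) → ℝ) ⊆ _
      simp [tsupport_zero]
    · refine integral_eq_zero_of_ae (Eventually.of_forall fun x => ?_)
      exact mul_zero _
  smul_mem' := by
    rintro c ψ ⟨h1, h2⟩
    refine ⟨(tsupport_smul_subset_right (fun _ => c) ψ).trans h1, fun k hk => ?_⟩
    have : ∀ x, (∏ i, x i ^ k i) * (c • ψ) x = c * ((∏ i, x i ^ k i) * ψ x) :=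
      fun x => mul_left_comm _ _ _
    simp_rw [this]
    rw [integral_const_mul, h2 k hk, mul_zero]

theorem tsupport_lineDerivOp_subset (v : EuclideanSpace ℝ (Fin d)) (θ : 𝓓(whole d, ℝ)) :
    tsupport (∂_{v} θ : 𝓓(whole d, ℝ)) ⊆ tsupport θ := by
  refine closure_minimal ?_ (isClosed_tsupport _)
  intro y hy
  by_contra h
  apply hy
  rw [lineDerivOp_testFunction_apply, fderiv_of_notMem_tsupport (𝕜 := ℝ) h]
  simp

/-- Integration by parts moves the derivative to the monomial, whose degree does not increase. -/
theorem lineDerivOp_mem_vanishing {m : ℕ} {ψ : 𝓓(whole d, ℝ)} (hψ : ψ ∈ vanishing d m)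
    (j : Fin d) : ∂_{EuclideanSpace.single j (1 : ℝ)} ψ ∈ vanishing d m := by
  refine ⟨(tsupport_lineDerivOp_subset _ _).trans hψ.1, fun k hk => ?_⟩
  have hd : ∀ i, Differentiable ℝ (fun t : ℝ => t ^ k i) := fun i => by fun_prop
  -- If `k j = 0` the subtraction truncates, but then the prefactor `k j` vanishes.
  have e1 : ∀ x : EuclideanSpace ℝ (Fin d),
      fderiv ℝ (fun x : EuclideanSpace ℝ (Fin d) => ∏ i, x i ^ k i) x (EuclideanSpace.single j 1) =
        k j * ∏ i, x i ^ (Function.update k j (k j - 1)) i := by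
    intro x
    rw [fderiv_prod_coord (a := fun i t => t ^ k i) hd x j, ← Finset.mul_prod_erase _ _
      (Finset.mem_univ j), ← mul_assoc]
    congr 1
    · simp
    · refine Finset.prod_congr rfl fun i hi => ?_
      rw [Function.update_of_ne (Finset.mem_erase.1 hi).1]
  have e2 : ∀ x : EuclideanSpace ℝ (Fin d),
      fderiv ℝ (fun x : EuclideanSpace ℝ (Fin d) => ∏ i, x i ^ k i) x (EuclideanSpace.single j 1) *
        ψ x = k j * ((∏ i, x i ^ (Function.update k j (k j - 1)) i) * ψ x) := by
    intro x
    rw [e1, mul_assoc]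
  have e3 : ∀ x, (∂_{EuclideanSpace.single j (1 : ℝ)} ψ : 𝓓(whole d, ℝ)) x =
    fderiv ℝ ψ x (EuclideanSpace.single j 1) := fun x => lineDerivOp_testFunction_apply _ _ _
  have e4 := integral_mul_fderiv_eq_neg_fderiv_mul_of_integrable (μ := volume)
    (f := fun x : EuclideanSpace ℝ (Fin d) => ∏ i, x i ^ k i) (g := ψ)
    (v := EuclideanSpace.single j 1)
    (by simp_rw [e2]; exact (integrable_monomial_mul _ ψ).const_mul _)
    (by simp_rw [← e3]; exact integrable_monomial_mul k _)
    (integrable_monomial_mul k ψ)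
    (fun x _ => differentiable_prod_coord (a := fun i t => t ^ k i) hd x)
    (fun x _ => ψ.contDiff.differentiable (by simp) x)
  simp_rw [← e3, e2] at e4
  rw [e4, integral_const_mul, hψ.2, mul_zero, neg_zero]
  refine le_trans (Finset.sum_le_sum fun i _ => ?_) hk
  by_cases hi : i = j
  · subst hi; simp
  · rw [Function.update_of_ne hi]

/-- The dilate `x ↦ h (s⁻¹ x)`. -/
def dilate (s : ℝ) (hs : 0 < s) (h : 𝓓(whole d, ℝ)) : 𝓓(whole d, ℝ) where
  toFun x := h (s⁻¹ • x)
  contDiff' := h.contDiff.comp (contDiff_id.const_smul _)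
  hasCompactSupport' := h.hasCompactSupport.comp_homeomorph
    (Homeomorph.smulOfNeZero s⁻¹ (inv_ne_zero hs.ne'))
  tsupport_subset' := by simp [whole]

theorem dilate_apply (s : ℝ) (hs : 0 < s) (h : 𝓓(whole d, ℝ)) (x : EuclideanSpace ℝ (Fin d)) :
    dilate s hs h x = h (s⁻¹ • x) := rfl

theorem tsupport_dilate_subset {s : ℝ} (hs : 0 < s) {h : 𝓓(whole d, ℝ)} {R : ℝ}
    (hR : tsupport h ⊆ Metric.closedBall 0 R) :
    tsupport (dilate s hs h) ⊆ Metric.closedBall 0 (s * R) := by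
  refine closure_minimal ?_ Metric.isClosed_closedBall
  intro y hy
  have h1 := hR (subset_tsupport _ (Function.mem_support.2 hy))
  rw [mem_closedBall_zero_iff] at h1 ⊢
  rw [norm_smul, norm_inv, Real.norm_of_nonneg hs.le, inv_mul_le_iff₀ hs] at h1
  exact h1

theorem integral_monomial_mul_dilate {s : ℝ} (hs : 0 < s) (h : 𝓓(whole d, ℝ)) (k : Fin d → ℕ) :
    ∫ x : EuclideanSpace ℝ (Fin d), (∏ i, x i ^ k i) * dilate s hs h x =
      s ^ d * (s ^ (∑ i, k i) * ∫ x : EuclideanSpace ℝ (Fin d), (∏ i, x i ^ k i) * h x) := by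
  have e := Measure.integral_comp_inv_smul (volume : Measure (EuclideanSpace ℝ (Fin d)))
    (fun x => s ^ (∑ i, k i) * ((∏ i, x i ^ k i) * h x)) s
  rw [finrank_euclideanSpace_fin, abs_of_pos (by positivity)] at e
  rw [← smul_eq_mul (s ^ d), ← integral_const_mul, ← e]
  refine integral_congr_ae (Eventually.of_forall fun x => ?_)
  simp only [dilate_apply, ← mul_assoc]
  congr 1
  rw [← Finset.prod_pow_eq_pow_sum, ← Finset.prod_mul_distrib]
  refine Finset.prod_congr rfl fun i _ => ?_
  rw [← mul_pow]
  congr 1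
  simp [hs.ne']

theorem lineDerivOp_dilate {s : ℝ} (hs : 0 < s) (h : 𝓓(whole d, ℝ))
    (v : EuclideanSpace ℝ (Fin d)) : ∂_{v} (dilate s hs h) = s⁻¹ • dilate s hs (∂_{v} h) := by
  ext x
  change _ = s⁻¹ * dilate s hs (∂_{v} h) x
  rw [lineDerivOp_testFunction_apply, dilate_apply, lineDerivOp_testFunction_apply]
  have h1 : HasFDerivAt (fun x => h (s⁻¹ • x)) ((fderiv ℝ h (s⁻¹ • x)).comp
      (s⁻¹ • ContinuousLinearMap.id ℝ _)) x :=
    HasFDerivAt.comp x ((h.contDiff.differentiable (by simp)) _).hasFDerivAt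
      ((hasFDerivAt_id x).const_smul s⁻¹)
  have e : (dilate s hs h : EuclideanSpace ℝ (Fin d) → ℝ) = fun x => h (s⁻¹ • x) := rfl
  rw [e, h1.fderiv]
  simp

/-- Lagrange interpolation at `M + 1` distinct nodes reproduces `X^l` for `l ≤ M`. Evaluating at `0`
gives the identities, with `c i` the value at `0` of the `i`-th basis polynomial; the nodes `δ / (i
+ 2)` are distinct and less than `δ`. -/
theorem exists_nodes (M : ℕ) {δ : ℝ} (hδ : 0 < δ) : ∃ c s : Fin (M + 1) → ℝ,
    (∀ i, 0 < s i ∧ s i < δ) ∧ ∑ i, c i = 1 ∧ ∀ l, 1 ≤ l → l ≤ M → ∑ i, c i * s i ^ l = 0 := by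
  let s : Fin (M + 1) → ℝ := fun i => δ / ((i : ℕ) + 2)
  have hinj : Set.InjOn s (Finset.univ : Finset (Fin (M + 1))) := by
    intro i _ j _ hij
    have h1 : ((i : ℕ) : ℝ) + 2 ≠ 0 := by positivity
    have h2 : ((j : ℕ) : ℝ) + 2 ≠ 0 := by positivity
    simp only [s] at hij
    rw [div_eq_div_iff h1 h2] at hij
    have := mul_left_cancel₀ hδ.ne' hij
    have h3 : ((j : ℕ) : ℝ) = (i : ℕ) := by linarith
    exact Fin.ext (by exact_mod_cast h3.symm)
  have key : ∀ l ≤ M, ∑ i, (Lagrange.basis Finset.univ s i).eval 0 * s i ^ l = (0 : ℝ) ^ l := by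
    intro l hl
    have h := Lagrange.eq_interpolate_of_eval_eq (s := Finset.univ) (v := s)
      (f := (Polynomial.X ^ l : Polynomial ℝ)) (fun i => s i ^ l) hinj
      (by
        rw [Polynomial.degree_X_pow, Finset.card_univ, Fintype.card_fin]
        exact_mod_cast Nat.lt_succ_of_le hl) (by simp)
    have h2 := congrArg (Polynomial.eval 0) h
    rw [Lagrange.interpolate_apply, Polynomial.eval_finsetSum] at h2
    simp only [Polynomial.eval_mul, Polynomial.eval_C, Polynomial.eval_pow, Polynomial.eval_X] at h2
    rw [h2]
    exact Finset.sum_congr rfl fun i _ => mul_comm _ _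
  refine ⟨fun i => (Lagrange.basis Finset.univ s i).eval 0, s, fun i => ⟨by positivity, ?_⟩, ?_, ?_⟩
  · exact div_lt_self hδ (by have : (0 : ℝ) ≤ (i : ℕ) := by positivity
                             linarith)
  · simpa using key 0 (Nat.zero_le _)
  · intro l hl1 hl2
    rw [key l hl2, zero_pow (by omega)]

/-- The product `x ↦ ∏ i, a i (x i)` of functions of one variable supported in `[0, 1]`. -/
def prodTest (a : Fin d → ℝ → ℝ) (ha : ∀ i, ContDiff ℝ ∞ (a i))
    (ha' : ∀ i t, t ∉ Icc (0 : ℝ) 1 → a i t = 0) : 𝓓(whole d, ℝ) where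
  toFun x := ∏ i, a i (x i)
  contDiff' := contDiff_prod_coord ha
  hasCompactSupport' := by
    refine HasCompactSupport.intro (isCompact_closedBall 0 (Real.sqrt d)) fun x hx => ?_
    by_contra h
    apply hx
    rw [mem_closedBall_zero_iff, EuclideanSpace.norm_eq]
    refine Real.sqrt_le_sqrt ?_
    have h1 : ∀ i, ‖x i‖ ^ 2 ≤ 1 := by
      intro i
      have h2 : x i ∈ Icc (0 : ℝ) 1 := by
        by_contra h3
        exact h (Finset.prod_eq_zero (Finset.mem_univ i) (ha' i _ h3))
      rw [Real.norm_of_nonneg h2.1]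
      exact pow_le_one₀ h2.1 h2.2
    calc _ ≤ ∑ i : Fin d, (1 : ℝ) := Finset.sum_le_sum fun i _ => h1 i
      _ = d := by simp
  tsupport_subset' := by simp [whole]

theorem prodTest_apply (a : Fin d → ℝ → ℝ) (ha : ∀ i, ContDiff ℝ ∞ (a i))
    (ha' : ∀ i t, t ∉ Icc (0 : ℝ) 1 → a i t = 0) (x : EuclideanSpace ℝ (Fin d)) :
    prodTest a ha ha' x = ∏ i, a i (x i) := rfl

/-- A smooth bump of integral one supported in `[0, 1]`. -/
def bump : ℝ → ℝ := deriv Real.smoothTransition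

theorem contDiff_bump : ContDiff ℝ ∞ bump :=
  (contDiff_infty_iff_deriv.1 Real.smoothTransition.contDiff).2

theorem bump_eq_zero {t : ℝ} (ht : t ∉ Icc (0 : ℝ) 1) : bump t = 0 := by
  rw [mem_Icc, not_and_or, not_le, not_le] at ht
  rcases ht with ht | ht
  · have : Real.smoothTransition =ᶠ[𝓝 t] fun _ => 0 := by
      filter_upwards [Iio_mem_nhds ht] with s hs
      exact Real.smoothTransition.zero_of_nonpos (le_of_lt hs)
    rw [bump, this.deriv_eq, deriv_const]
  · have : Real.smoothTransition =ᶠ[𝓝 t] fun _ => 1 := by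
      filter_upwards [Ioi_mem_nhds ht] with s hs
      exact Real.smoothTransition.one_of_one_le (le_of_lt hs)
    rw [bump, this.deriv_eq, deriv_const]

theorem integral_bump : ∫ t, bump t = 1 := by
  have hd : ∀ x, HasDerivAt Real.smoothTransition (bump x) x := fun x =>
    ((Real.smoothTransition.contDiff (n := 1)).differentiable (by simp) x).hasDerivAt
  have h := integral_of_hasDerivAt_of_tendsto (m := 0) (n := 1) hd
    (contDiff_bump.continuous.integrable_of_hasCompactSupport
      (HasCompactSupport.intro isCompact_Icc fun t ht => bump_eq_zero ht))
    (tendsto_const_nhds.congr' (by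
      filter_upwards [eventually_le_atBot (0 : ℝ)] with t ht
      exact (Real.smoothTransition.zero_of_nonpos ht).symm))
    (tendsto_const_nhds.congr' (by
      filter_upwards [eventually_ge_atTop (1 : ℝ)] with t ht
      exact (Real.smoothTransition.one_of_one_le ht).symm))
  rw [h, sub_zero]

/-- A primitive of `t ↦ 2 * bump (2 * t) - bump t` supported in `[0, 1]`. -/
def bumpPrimitive (t : ℝ) : ℝ := Real.smoothTransition (2 * t) - Real.smoothTransition t

theorem contDiff_bumpPrimitive : ContDiff ℝ ∞ bumpPrimitive :=
  (Real.smoothTransition.contDiff.comp (contDiff_const.mul contDiff_id)).sub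
    Real.smoothTransition.contDiff

theorem bumpPrimitive_eq_zero {t : ℝ} (ht : t ∉ Icc (0 : ℝ) 1) : bumpPrimitive t = 0 := by
  rw [mem_Icc, not_and_or, not_le, not_le] at ht
  rcases ht with ht | ht
  · rw [bumpPrimitive, Real.smoothTransition.zero_of_nonpos ht.le,
      Real.smoothTransition.zero_of_nonpos (by linarith), sub_zero]
  · rw [bumpPrimitive, Real.smoothTransition.one_of_one_le ht.le,
      Real.smoothTransition.one_of_one_le (by linarith), sub_self]

theorem deriv_bumpPrimitive (t : ℝ) : deriv bumpPrimitive t = 2 * bump (2 * t) - bump t := by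
  have hd : ∀ x, HasDerivAt Real.smoothTransition (bump x) x := fun x =>
    ((Real.smoothTransition.contDiff (n := 1)).differentiable (by simp) x).hasDerivAt
  have h2 : HasDerivAt (fun t : ℝ => 2 * t) 2 t := by
    simpa using (hasDerivAt_id t).const_mul 2
  have h := ((hd (2 * t)).comp t h2).sub (hd t)
  rw [HasDerivAt.deriv (f := bumpPrimitive) h, mul_comm]

theorem two_mul_bump_eq_zero {t : ℝ} (ht : t ∉ Icc (0 : ℝ) 1) : 2 * bump (2 * t) = 0 := by
  rw [bump_eq_zero, mul_zero]
  contrapose! ht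
  exact ⟨by linarith [ht.1], by linarith [ht.2]⟩

/-- The factors of the `j`-th term in a telescoping expansion. -/
def telescopeFactor (j i : Fin d) : ℝ → ℝ :=
  if i = j then bumpPrimitive else if i < j then fun t => 2 * bump (2 * t) else bump

theorem contDiff_telescopeFactor (j i : Fin d) : ContDiff ℝ ∞ (telescopeFactor j i) := by
  unfold telescopeFactor
  split_ifs
  · exact contDiff_bumpPrimitive
  · exact contDiff_const.mul (contDiff_bump.comp (contDiff_const.mul contDiff_id))
  · exact contDiff_bump

theorem telescopeFactor_eq_zero (j i : Fin d) (t : ℝ) (ht : t ∉ Icc (0 : ℝ) 1) :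
    telescopeFactor j i t = 0 := by
  unfold telescopeFactor
  split_ifs
  · exact bumpPrimitive_eq_zero ht
  · exact two_mul_bump_eq_zero ht
  · exact bump_eq_zero ht

/-- The product bump. -/
def prodBump (d : ℕ) : 𝓓(whole d, ℝ) :=
  prodTest (fun _ => bump) (fun _ => contDiff_bump) (fun _ _ ht => bump_eq_zero ht)

/-- The components of a vector field with divergence `2 ^ d * prodBump (2 x) - prodBump x`. -/
def prodBumpField (j : Fin d) : 𝓓(whole d, ℝ) :=
  prodTest (telescopeFactor j) (contDiff_telescopeFactor j) (telescopeFactor_eq_zero j)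

theorem integral_prodBump : ∫ x, prodBump d x = 1 := by
  have h := (PiLp.volume_preserving_ofLp (Fin d)).integral_comp
    (MeasurableEquiv.toLp 2 (Fin d → ℝ)).symm.measurableEmbedding
    (fun y : Fin d → ℝ => ∏ i, bump (y i))
  have e : ∀ x, prodBump d x = ∏ i, bump (x i) := fun x => rfl
  simp_rw [e]
  rw [h, integral_fintype_prod_volume_eq_prod (fun _ : Fin d => bump)]
  simp [integral_bump]

/-- Replace the factors `bump (x i)` by `2 * bump (2 * x i)` one coordinate at a time. The
difference made at coordinate `j` is a derivative in `x j` alone, because `2 * bump (2 * t) - bump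
t` has integral zero and hence a compactly supported primitive. -/
theorem sum_lineDerivOp_prodBumpField (x : EuclideanSpace ℝ (Fin d)) :
    ∑ j, (∂_{EuclideanSpace.single j (1 : ℝ)} (prodBumpField j) : 𝓓(whole d, ℝ)) x =
      2 ^ d * prodBump d ((2 : ℝ) • x) - prodBump d x := by
  have h := Finset.prod_add_ordered Finset.univ (fun i => bump (x i))
    (fun i => 2 * bump (2 * x i) - bump (x i))
  simp only [add_sub_cancel] at h
  have e1 : ∏ i, 2 * bump (2 * x i) = 2 ^ d * prodBump d ((2 : ℝ) • x) := by
    rw [Finset.prod_mul_distrib]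
    simp [prodBump, prodTest_apply]
  have e2 : ∏ i, bump (x i) = prodBump d x := rfl
  rw [e1, e2] at h
  rw [h, add_sub_cancel_left]
  refine Finset.sum_congr rfl fun j _ => ?_
  rw [lineDerivOp_testFunction_apply]
  have e3 := fderiv_prod_coord (a := telescopeFactor j)
    (fun i => (contDiff_telescopeFactor j i).differentiable (by simp)) x j
  refine Eq.trans e3 ?_
  rw [mul_assoc]
  congr 1
  · simp [telescopeFactor, deriv_bumpPrimitive]
  · have e4 : (Finset.univ.erase j : Finset (Fin d)) =
        Finset.univ.filter (· < j) ∪ Finset.univ.filter (j < ·) := by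
      ext i
      simp [lt_or_lt_iff_ne]
    rw [e4, Finset.prod_union]
    · congr 1
      · refine Finset.prod_congr rfl fun i hi => ?_
        have : i < j := by simpa using hi
        simp [telescopeFactor, this, this.ne]
      · refine Finset.prod_congr rfl fun i hi => ?_
        have : j < i := by simpa using hi
        simp [telescopeFactor, this.ne', this.not_gt]
    · rw [Finset.disjoint_filter]
      intro i _ h1 h2
      exact absurd h1 h2.not_gt

/-- A mollifier `ρ` for which `2 ^ d * ρ (2 x) - ρ x` is the divergence of a vector field with
vanishing moments. -/
theorem exists_mollifier (d m : ℕ) : ∃ (ρ ψ : 𝓓(whole d, ℝ)) (η : Fin d → 𝓓(whole d, ℝ)),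
    ∫ x, ρ x = 1 ∧ (∀ x, ψ x = 2 ^ d * ρ ((2 : ℝ) • x) - ρ x) ∧
      ψ = ∑ j, ∂_{EuclideanSpace.single j (1 : ℝ)} (η j) ∧ ψ ∈ vanishing d m ∧
        ∀ j, η j ∈ vanishing d m := by
  have hfield : ∀ j : Fin d, ∃ R : ℝ, 0 ≤ R ∧ tsupport (prodBumpField j) ⊆ Metric.closedBall 0 R :=
    fun j => exists_tsupport_subset_closedBall (prodBumpField j).hasCompactSupport
  choose R hR0 hR using hfield
  have hS0 : 0 ≤ ∑ j, R j := Finset.sum_nonneg fun j _ => hR0 j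
  -- The order is `m + 1` because the extra factor `s i` in `η` turns a moment of degree `|k|` into
  -- `∑ c i * s i ^ (|k| + 1)`. The bound `δ` puts the supports of all dilated fields in the unit
  -- ball.
  obtain ⟨c, s, hs, hc1, hcl⟩ := exists_nodes (m + 1) (δ := (∑ j, R j + 1)⁻¹) (by positivity)
  let ρ : 𝓓(whole d, ℝ) := ∑ i, (c i * (s i ^ d)⁻¹) • dilate (s i) (hs i).1 (prodBump d)
  -- The extra `s i` compensates the factor `(s i)⁻¹` produced by differentiating a dilate, so the
  -- divergence carries the same coefficients as `ρ`.
  let η : Fin d → 𝓓(whole d, ℝ) := fun j =>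
    ∑ i, (c i * s i * (s i ^ d)⁻¹) • dilate (s i) (hs i).1 (prodBumpField j)
  have sum_apply : ∀ {ι : Type} (t : Finset ι) (g : ι → 𝓓(whole d, ℝ)) x,
      (∑ i ∈ t, g i : 𝓓(whole d, ℝ)) x = ∑ i ∈ t, g i x := by
    intro ι t g x
    exact map_sum (⟨⟨fun h : 𝓓(whole d, ℝ) => h x, rfl⟩, fun _ _ => rfl⟩ : 𝓓(whole d, ℝ) →+ ℝ) g t
  have hρ : ∀ x, ρ x = ∑ i, c i * (s i ^ d)⁻¹ * prodBump d ((s i)⁻¹ • x) := fun x =>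
    sum_apply _ _ x
  have hη : ∀ j x, η j x = ∑ i, c i * s i * (s i ^ d)⁻¹ * dilate (s i) (hs i).1 (prodBumpField j) x :=
    fun j x => sum_apply _ _ x
  have hηmem : ∀ j, η j ∈ vanishing d m := by
    intro j
    constructor
    · have h1 : ∀ i, tsupport ((c i * s i * (s i ^ d)⁻¹) • dilate (s i) (hs i).1 (prodBumpField j) :
          𝓓(whole d, ℝ)) ⊆ Metric.ball 0 1 := by
        intro i
        refine (tsupport_smul_subset_right (fun _ => c i * s i * (s i ^ d)⁻¹) _).trans ?_
        refine (tsupport_dilate_subset (hs i).1 (hR j)).trans ?_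
        refine Metric.closedBall_subset_ball ?_
        have h2 : R j ≤ ∑ j, R j := Finset.single_le_sum (fun j _ => hR0 j) (Finset.mem_univ j)
        have h3 : s i * (∑ j, R j + 1) < 1 := by
          have := mul_lt_mul_of_pos_right (hs i).2 (by positivity : 0 < ∑ j, R j + 1)
          rwa [inv_mul_cancel₀ (by positivity)] at this
        have h4 : s i * R j ≤ s i * (∑ j, R j + 1) :=
          mul_le_mul_of_nonneg_left (by linarith) (hs i).1.le
        linarith
      refine Finset.sum_induction _ (fun g : 𝓓(whole d, ℝ) => tsupport g ⊆ Metric.ball 0 1)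
        (fun a b ha hb => (tsupport_add a b).trans (union_subset ha hb)) ?_ (fun i _ => h1 i)
      change tsupport (0 : EuclideanSpace ℝ (Fin d) → ℝ) ⊆ _
      simp [tsupport_zero]
    · intro k hk
      have e1 : ∀ x : EuclideanSpace ℝ (Fin d), (∏ i, x i ^ k i) * η j x =
          ∑ i, c i * s i * (s i ^ d)⁻¹ *
            ((∏ i, x i ^ k i) * dilate (s i) (hs i).1 (prodBumpField j) x) := by
        intro x
        rw [hη, Finset.mul_sum]
        exact Finset.sum_congr rfl fun i _ => mul_left_comm _ _ _
      simp_rw [e1]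
      rw [integral_finsetSum _ fun i _ => (integrable_monomial_mul k _).const_mul _]
      simp_rw [integral_const_mul, integral_monomial_mul_dilate]
      have e2 : ∀ i, c i * s i * (s i ^ d)⁻¹ * (s i ^ d * (s i ^ (∑ i, k i) *
          ∫ x : EuclideanSpace ℝ (Fin d), (∏ i, x i ^ k i) * prodBumpField j x)) =
          c i * s i ^ (∑ i, k i + 1) *
            ∫ x : EuclideanSpace ℝ (Fin d), (∏ i, x i ^ k i) * prodBumpField j x := by
        intro i
        have : s i ^ d ≠ 0 := (pow_pos (hs i).1 d).ne'
        field_simp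
        ring
      simp_rw [e2]
      rw [← Finset.sum_mul, hcl _ (by omega) (by omega), zero_mul]
  refine ⟨ρ, ∑ j, ∂_{EuclideanSpace.single j (1 : ℝ)} (η j), η, ?_, ?_, rfl, ?_, hηmem⟩
  · have h1 : ∀ i, ∫ x, dilate (s i) (hs i).1 (prodBump d) x = s i ^ d := by
      intro i
      have := integral_monomial_mul_dilate (hs i).1 (prodBump d) 0
      simpa [integral_prodBump] using this
    have h2 : ∀ x, ρ x = ∑ i, c i * (s i ^ d)⁻¹ * dilate (s i) (hs i).1 (prodBump d) x := hρ
    have hint : ∀ i, Integrable fun x => dilate (s i) (hs i).1 (prodBump d) x := fun i =>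
      (dilate (s i) (hs i).1 (prodBump d)).continuous.integrable_of_hasCompactSupport
        (dilate (s i) (hs i).1 (prodBump d)).hasCompactSupport
    simp_rw [h2]
    rw [integral_finsetSum _ fun i _ => (hint i).const_mul _]
    simp_rw [integral_const_mul, h1]
    rw [← hc1]
    refine Finset.sum_congr rfl fun i _ => ?_
    have : s i ^ d ≠ 0 := (pow_pos (hs i).1 d).ne'
    field_simp
  · intro x
    rw [sum_apply]
    have e1 : ∀ j, (∂_{EuclideanSpace.single j (1 : ℝ)} (η j) : 𝓓(whole d, ℝ)) x =
        ∑ i, c i * (s i ^ d)⁻¹ *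
          (∂_{EuclideanSpace.single j (1 : ℝ)} (prodBumpField j) : 𝓓(whole d, ℝ))
            ((s i)⁻¹ • x) := by
      intro j
      have e2 : ∂_{EuclideanSpace.single j (1 : ℝ)} (η j) =
          ∑ i, (c i * s i * (s i ^ d)⁻¹) •
            ∂_{EuclideanSpace.single j (1 : ℝ)} (dilate (s i) (hs i).1 (prodBumpField j)) := by
        change TestFunction.lineDerivCLM ℝ _ (η j) = _
        rw [map_sum]
        exact Finset.sum_congr rfl fun i _ => map_smul _ _ _
      rw [e2, sum_apply]
      refine Finset.sum_congr rfl fun i _ => ?_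
      rw [lineDerivOp_dilate]
      change c i * s i * (s i ^ d)⁻¹ * ((s i)⁻¹ *
        (∂_{EuclideanSpace.single j (1 : ℝ)} (prodBumpField j) : 𝓓(whole d, ℝ)) ((s i)⁻¹ • x)) = _
      have : s i ≠ 0 := (hs i).1.ne'
      field_simp
    simp_rw [e1]
    rw [Finset.sum_comm, hρ, hρ, Finset.mul_sum, ← Finset.sum_sub_distrib]
    refine Finset.sum_congr rfl fun i _ => ?_
    rw [← Finset.mul_sum, sum_lineDerivOp_prodBumpField, smul_comm (s i)⁻¹ (2 : ℝ) x]
    ring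
  · exact Submodule.sum_mem _ fun j _ => lineDerivOp_mem_vanishing (hηmem j) j

/-! ### From the Besov norm to square-summable decay -/

theorem rescale_const_smul (n : ℕ) (x : EuclideanSpace ℝ (Fin d)) (c : ℝ) (ψ : 𝓓(whole d, ℝ)) :
    rescale n x (c • ψ) = c • rescale n x ψ := by
  ext y
  change ((2 : ℝ) ^ n) ^ d * (c * ψ ((2 : ℝ) ^ n • (x - y))) =
    c * (((2 : ℝ) ^ n) ^ d * ψ ((2 : ℝ) ^ n • (x - y)))
  ring

/-- A fixed test function has finite `C^r` norm for every `r`, so normalizing it costs only a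
constant. This is why the choice of `r` plays no role. -/
theorem exists_smul_mem_unitTestMoments (r : ℕ) {m : ℕ} {ψ : 𝓓(whole d, ℝ)}
    (hψ : ψ ∈ vanishing d m) : ∃ c : ℝ, 0 < c ∧ c • ψ ∈ unitTestMoments d r m := by
  have hb : ∀ k : ℕ, ∃ M : ℝ, ∀ x, ‖iteratedFDeriv ℝ k ψ x‖ ≤ M := fun k =>
    (ψ.hasCompactSupport.iteratedFDeriv k).exists_bound_of_continuous
      (contDiff_iteratedFDeriv_testFunction ψ k).continuous
  choose M hM using hb
  have hM0 : ∀ k, 0 ≤ M k := fun k => (norm_nonneg _).trans (hM k 0)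
  have hS : 0 ≤ ∑ k ∈ Finset.range (r + 1), M k := Finset.sum_nonneg fun k _ => hM0 k
  have hc : 0 < (1 + ∑ k ∈ Finset.range (r + 1), M k)⁻¹ := by positivity
  have hmem := (vanishing d m).smul_mem (1 + ∑ k ∈ Finset.range (r + 1), M k)⁻¹ hψ
  refine ⟨_, hc, ⟨hmem.1, fun k hk x => ?_⟩, hmem.2⟩
  have e : iteratedFDeriv ℝ k ((1 + ∑ k ∈ Finset.range (r + 1), M k)⁻¹ • ψ : 𝓓(whole d, ℝ)) x =
      (1 + ∑ k ∈ Finset.range (r + 1), M k)⁻¹ • iteratedFDeriv ℝ k ψ x :=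
    iteratedFDeriv_const_smul_apply (ψ.contDiff.of_le (mod_cast le_top)).contDiffAt
  rw [e, norm_smul, Real.norm_of_nonneg hc.le, inv_mul_le_iff₀ (by positivity), mul_one]
  have := Finset.single_le_sum (f := M) (fun i _ => hM0 i) (Finset.mem_range.2 (Nat.lt_succ_of_le hk))
  linarith [hM k x]

theorem exists_mul_enorm_le_supTest (f : 𝓓'(whole d, ℂ)) (r : ℕ) {m : ℕ} {ψ : 𝓓(whole d, ℝ)}
    (hψ : ψ ∈ vanishing d m) : ∃ c : ℝ, 0 < c ∧ ∀ n x,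
      ‖c‖ₑ * ‖f (rescale n x ψ)‖ₑ ≤ supTest f (unitTestMoments d r m) n x := by
  obtain ⟨c, hc, h⟩ := exists_smul_mem_unitTestMoments r hψ
  refine ⟨c, hc, fun n x => ?_⟩
  have := le_iSup₂ (f := fun ψ (_ : ψ ∈ unitTestMoments d r m) => ‖f (rescale n x ψ)‖ₑ) _ h
  rwa [rescale_const_smul, map_smul, enorm_smul] at this

/-- The supremum dominates one test function up to normalization, and Hölder on the finite-measure
set `K` passes from `L^p` to `L²`; neither constant depends on `n`. -/
theorem exists_eLpNorm_two_le {f : 𝓓'(whole d, ℂ)} (r : ℕ) {m : ℕ} {ψ : 𝓓(whole d, ℝ)}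
    (hψ : ψ ∈ vanishing d m) (α : ℝ) {p : ℝ≥0∞} (hp : 2 ≤ p) {K : Set (EuclideanSpace ℝ (Fin d))}
    (hK : IsCompact K) : ∃ C : ℝ≥0∞, C ≠ ⊤ ∧ ∀ n : ℕ,
      (2 : ℝ≥0∞) ^ ((n : ℝ) * α) * eLpNorm (fun x => f (rescale n x ψ)) 2 (volume.restrict K) ≤
        C * eLpNorm (fun x => (2 : ℝ≥0∞) ^ ((n : ℝ) * α) *
          supTest f (unitTestMoments d r m) n x) p (volume.restrict K) := by
  obtain ⟨c, hc, h⟩ := exists_mul_enorm_le_supTest f r hψ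
  have hc0 : ‖c‖ₑ ≠ 0 := by simpa using hc.ne'
  set e : ℝ := 1 / (2 : ℝ≥0∞).toReal - 1 / p.toReal
  have he : 0 ≤ e := by
    rcases eq_or_ne p ⊤ with rfl | hpt
    · simp [e]
    · have h2 : (2 : ℝ≥0∞).toReal ≤ p.toReal := ENNReal.toReal_mono hpt hp
      exact sub_nonneg.2 (one_div_le_one_div_of_le (by simp) h2)
  refine ⟨‖c‖ₑ⁻¹ * volume K ^ e,
    ENNReal.mul_ne_top (ENNReal.inv_ne_top.2 hc0) (ENNReal.rpow_ne_top_of_nonneg he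
      hK.measure_lt_top.ne), fun n => ?_⟩
  have h2n : ‖((2 : ℝ) ^ ((n : ℝ) * α))‖ₑ = (2 : ℝ≥0∞) ^ ((n : ℝ) * α) := by
    rw [Real.enorm_of_nonneg (by positivity), ← ENNReal.ofReal_rpow_of_pos two_pos]
    simp
  have h1 : ‖c‖ₑ * ((2 : ℝ≥0∞) ^ ((n : ℝ) * α) *
      eLpNorm (fun x => f (rescale n x ψ)) p (volume.restrict K)) ≤
      eLpNorm (fun x => (2 : ℝ≥0∞) ^ ((n : ℝ) * α) *
          supTest f (unitTestMoments d r m) n x) p (volume.restrict K) := by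
    rw [← mul_assoc, mul_comm ‖c‖ₑ, ← h2n, ← enorm_mul, ← eLpNorm_const_smul]
    refine eLpNorm_mono_enorm fun x => ?_
    rw [Pi.smul_apply, enorm_smul, enorm_mul, mul_assoc, h2n]
    exact mul_le_mul_right (h n x) _
  -- Hölder is applied to the continuous function `x ↦ f (rescale n x ψ)`, so measurability of the
  -- supremum is never needed.
  have h3 := eLpNorm_le_eLpNorm_mul_rpow_measure_univ (μ := volume.restrict K) hp
    (contDiff_apply_rescale f n ψ).continuous.aestronglyMeasurable
  rw [Measure.restrict_apply_univ] at h3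
  calc _ ≤ (2 : ℝ≥0∞) ^ ((n : ℝ) * α) *
        (eLpNorm (fun x => f (rescale n x ψ)) p (volume.restrict K) * volume K ^ e) := by gcongr
    _ = ‖c‖ₑ⁻¹ * volume K ^ e * (‖c‖ₑ * ((2 : ℝ≥0∞) ^ ((n : ℝ) * α) *
          eLpNorm (fun x => f (rescale n x ψ)) p (volume.restrict K))) := by
        rw [show ∀ a b u v : ℝ≥0∞, a * v * (b * u) = (a * b) * (u * v) by intros; ring,
          ENNReal.inv_mul_cancel hc0 enorm_ne_top, one_mul, mul_assoc]
    _ ≤ _ := by gcongr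

theorem scaleNorm_lt_top_of_mem_besovLoc {f : 𝓓'(whole d, ℂ)} {α : ℝ} (hα : 0 ≤ α) {p q : ℝ≥0∞}
    {r : ℕ} (hf : f ∈ besovLoc d α p q r) {K : Set (EuclideanSpace ℝ (Fin d))}
    (hK : IsCompact K) : scaleNorm f (unitTestMoments d r ⌊α⌋₊) α p q K < ⊤ := by
  have := hf K hK
  rw [if_neg hα.not_gt] at this
  exact (ENNReal.add_lt_top.1 this).2

/-- The pairings of `f` with all rescaled test functions whose moments up to order `m` vanish
decay in `L²_loc` like `2^{-nσ}`, square summably in the scale `n`. -/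
def SquareDecay (f : 𝓓'(whole d, ℂ)) (m : ℕ) (σ : ℝ) : Prop :=
  ∀ K : Set (EuclideanSpace ℝ (Fin d)), IsCompact K → ∀ ψ ∈ vanishing d m,
    ∑' n : ℕ, ENNReal.ofReal (4 ^ (n * σ)) * ∫⁻ x in K, ‖f (rescale n x ψ)‖ₑ ^ 2 ≠ ⊤

theorem ofReal_four_rpow_mul_lintegral (g : EuclideanSpace ℝ (Fin d) → ℂ)
    (K : Set (EuclideanSpace ℝ (Fin d))) (t : ℝ) :
    ENNReal.ofReal (4 ^ t) * ∫⁻ x in K, ‖g x‖ₑ ^ 2 =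
      ((2 : ℝ≥0∞) ^ t * eLpNorm g 2 (volume.restrict K)) ^ 2 := by
  have h := eLpNorm_nnreal_pow_eq_lintegral (μ := volume.restrict K) (f := g) (p := 2) (by simp)
  norm_num at h
  rw [mul_pow, h]
  congr 1
  rw [← ENNReal.rpow_natCast, ← ENNReal.rpow_mul, mul_comm t, ENNReal.rpow_mul,
    ← ENNReal.ofReal_rpow_of_pos (by norm_num)]
  norm_num

theorem squareDecay_of_mem_besovLoc {f : 𝓓'(whole d, ℂ)} {α : ℝ} (hα : 0 ≤ α) {p : ℝ≥0∞}
    (hp : 2 ≤ p) {r : ℕ} (hf : f ∈ besovLoc d α p 2 r) : SquareDecay f ⌊α⌋₊ α := by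
  intro K hK ψ hψ
  obtain ⟨C, hC, h⟩ := exists_eLpNorm_two_le (f := f) r hψ α hp hK
  have hs := scaleNorm_lt_top_of_mem_besovLoc hα hf hK
  have h2 := ENNReal.pow_lt_top (n := 2) hs
  rw [scaleNorm] at h2
  have h3 := eLpNorm_nnreal_pow_eq_lintegral (μ := Measure.count) (p := 2) (by simp)
    (f := fun n : ℕ => eLpNorm (fun x => (2 : ℝ≥0∞) ^ ((n : ℝ) * α) *
          supTest f (unitTestMoments d r ⌊α⌋₊) n x) p (volume.restrict K))
  norm_num at h3
  rw [h3, lintegral_count] at h2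
  refine ne_top_of_le_ne_top (ENNReal.mul_ne_top (ENNReal.pow_ne_top hC (n := 2)) h2.ne) ?_
  rw [← ENNReal.tsum_mul_left]
  refine ENNReal.tsum_le_tsum fun n => ?_
  rw [ofReal_four_rpow_mul_lintegral, ← mul_pow]
  exact pow_le_pow_left' (h n) 2

/-- Any `ℓ^q` norm with `q ≠ 0` bounds each single term, and the loss `σ < α` leaves a geometric
series of ratio `4^(σ - α)`. -/
theorem squareDecay_of_mem_besovLoc_of_lt {f : 𝓓'(whole d, ℂ)} {α σ : ℝ} (hα : 0 ≤ α)
    (hσ : σ < α) {p q : ℝ≥0∞} (hp : 2 ≤ p) (hq : q ≠ 0) {r : ℕ}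
    (hf : f ∈ besovLoc d α p q r) : SquareDecay f ⌊α⌋₊ σ := by
  intro K hK ψ hψ
  obtain ⟨C, hC, h⟩ := exists_eLpNorm_two_le (f := f) r hψ α hp hK
  have hs := scaleNorm_lt_top_of_mem_besovLoc hα hf hK
  set M := scaleNorm f (unitTestMoments d r ⌊α⌋₊) α p q K
  have hM : ∀ n : ℕ, (2 : ℝ≥0∞) ^ ((n : ℝ) * α) *
      eLpNorm (fun x => f (rescale n x ψ)) 2 (volume.restrict K) ≤ C * M := fun n =>
    (h n).trans (mul_le_mul_right (enorm_le_eLpNorm_count (fun n : ℕ => eLpNorm (fun x =>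
      (2 : ℝ≥0∞) ^ ((n : ℝ) * α) * supTest f (unitTestMoments d r ⌊α⌋₊) n x) p
        (volume.restrict K)) n hq) _)
  set ρ : ℝ≥0∞ := ENNReal.ofReal (4 ^ (σ - α))
  have hρ : ρ < 1 := by
    rw [ENNReal.ofReal_lt_one]
    exact Real.rpow_lt_one_of_one_lt_of_neg (by norm_num) (by linarith)
  refine ne_top_of_le_ne_top (b := (1 - ρ)⁻¹ * (C * M) ^ 2) (ENNReal.mul_ne_top
    (ENNReal.inv_ne_top.2 (tsub_pos_of_lt hρ).ne')
    (ENNReal.pow_ne_top (ENNReal.mul_ne_top hC hs.ne))) ?_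
  rw [← ENNReal.tsum_geometric, ← ENNReal.tsum_mul_right]
  refine ENNReal.tsum_le_tsum fun n => ?_
  have e : ENNReal.ofReal (4 ^ (n * σ)) = ρ ^ n * ENNReal.ofReal (4 ^ (n * α)) := by
    rw [← ENNReal.ofReal_pow (by positivity), ← ENNReal.ofReal_mul (by positivity),
      ← Real.rpow_mul_natCast (by norm_num), ← Real.rpow_add (by norm_num)]
    congr 2
    ring
  rw [e, mul_assoc, ofReal_four_rpow_mul_lintegral]
  exact mul_le_mul_right (pow_le_pow_left' (hM n) 2) _

/-! ### Localized pieces and their Fourier energies -/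

/-- The Schwartz function `x ↦ φ(x) f(ψ^{2^{-n}}_x)`. -/
def piece (f : 𝓓'(whole d, ℂ)) (φ : 𝓓(whole d, ℂ)) (n : ℕ) (ψ : 𝓓(whole d, ℝ)) :
    𝓢(EuclideanSpace ℝ (Fin d), ℂ) :=
  HasCompactSupport.toSchwartzMap (f := fun x => φ x * f (rescale n x ψ))
    φ.hasCompactSupport.mul_right (φ.contDiff.mul (contDiff_apply_rescale f n ψ))

theorem piece_apply (f : 𝓓'(whole d, ℂ)) (φ : 𝓓(whole d, ℂ)) (n : ℕ) (ψ : 𝓓(whole d, ℝ))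
    (x : EuclideanSpace ℝ (Fin d)) : piece f φ n ψ x = φ x * f (rescale n x ψ) := rfl

theorem lineDerivOp_piece (f : 𝓓'(whole d, ℂ)) (φ : 𝓓(whole d, ℂ)) (n : ℕ) (ψ : 𝓓(whole d, ℝ))
    (v : EuclideanSpace ℝ (Fin d)) :
    ∂_{v} (piece f φ n ψ) = piece f (∂_{v} φ) n ψ + (2 : ℝ) ^ n • piece f φ n (∂_{v} ψ) := by
  ext x
  rw [SchwartzMap.lineDerivOp_apply_eq_fderiv]
  change fderiv ℝ (fun x => φ x * f (rescale n x ψ)) x v =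
    (∂_{v} φ : 𝓓(whole d, ℂ)) x * f (rescale n x ψ) +
      ((2 : ℝ) ^ n) • (φ x * f (rescale n x (∂_{v} ψ)))
  rw [fderiv_fun_mul (φ.contDiff.differentiable (by simp) x)
    ((contDiff_apply_rescale f n ψ).differentiable (by simp) x)]
  change φ x • fderiv ℝ (fun x => f (rescale n x ψ)) x v +
    f (rescale n x ψ) • fderiv ℝ φ x v = _
  rw [fderiv_apply_rescale, lineDerivOp_testFunction_apply, Complex.real_smul, smul_eq_mul,
    smul_eq_mul]
  push_cast
  ring

/-- The squared `L²` norm of the Fourier transform with weight `(1 + ‖ξ‖²)^t`. -/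
def energy (t : ℝ) (G : 𝓢(EuclideanSpace ℝ (Fin d), ℂ)) : ℝ≥0∞ :=
  ∫⁻ ξ, ENNReal.ofReal ((1 + ‖ξ‖ ^ 2) ^ t) * ‖𝓕 G ξ‖ₑ ^ 2

theorem measurable_weight (t : ℝ) :
    Measurable fun ξ : EuclideanSpace ℝ (Fin d) => ENNReal.ofReal ((1 + ‖ξ‖ ^ 2) ^ t) := by
  fun_prop

theorem measurable_energy_integrand (t : ℝ) (G : 𝓢(EuclideanSpace ℝ (Fin d), ℂ)) :
    Measurable fun ξ => ENNReal.ofReal ((1 + ‖ξ‖ ^ 2) ^ t) * ‖𝓕 G ξ‖ₑ ^ 2 :=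
  (measurable_weight t).mul ((𝓕 G).continuous.measurable.enorm.pow_const 2)

theorem enorm_add_sq_le (a b : ℂ) : ‖a + b‖ₑ ^ 2 ≤ 2 * ‖a‖ₑ ^ 2 + 2 * ‖b‖ₑ ^ 2 := by
  have h := ENNReal.rpow_add_le_mul_rpow_add_rpow ‖a‖ₑ ‖b‖ₑ (one_le_two : (1 : ℝ) ≤ 2)
  norm_num at h
  rw [mul_add] at h
  exact (pow_le_pow_left' (enorm_add_le a b) 2).trans h

theorem energy_add_le (t : ℝ) (G H : 𝓢(EuclideanSpace ℝ (Fin d), ℂ)) :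
    energy t (G + H) ≤ 2 * energy t G + 2 * energy t H := by
  rw [energy, energy, energy, ← lintegral_const_mul _ (measurable_energy_integrand t G),
    ← lintegral_const_mul _ (measurable_energy_integrand t H),
    ← lintegral_add_left ((measurable_energy_integrand t G).const_mul 2)]
  refine lintegral_mono fun ξ => ?_
  change _ * ‖𝓕 (G + H) ξ‖ₑ ^ 2 ≤ _
  have e : 𝓕 (G + H) ξ = 𝓕 G ξ + 𝓕 H ξ := by rw [FourierTransform.fourier_add]; rfl
  rw [e]
  refine (mul_le_mul_right (enorm_add_sq_le _ _) _).trans (le_of_eq ?_)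
  ring

theorem energy_smul (t : ℝ) (c : ℝ) (G : 𝓢(EuclideanSpace ℝ (Fin d), ℂ)) :
    energy t (c • G) = ENNReal.ofReal (c ^ 2) * energy t G := by
  rw [energy, energy, ← lintegral_const_mul _ (measurable_energy_integrand t G)]
  refine lintegral_congr fun ξ => ?_
  have e : 𝓕 (c • G) ξ = c • 𝓕 G ξ := by
    have : c • G = (c : ℂ) • G := by ext; simp
    rw [this, FourierTransform.fourier_smul]
    simp
  rw [e, enorm_smul, mul_pow, ← sq_abs c, ENNReal.ofReal_pow (abs_nonneg c),
    ← Real.enorm_eq_ofReal_abs]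
  ring

theorem energy_mono {s t : ℝ} (h : s ≤ t) (G : 𝓢(EuclideanSpace ℝ (Fin d), ℂ)) :
    energy s G ≤ energy t G := by
  refine lintegral_mono fun ξ => ?_
  have : (1 : ℝ) ≤ 1 + ‖ξ‖ ^ 2 := by linarith [sq_nonneg ‖ξ‖]
  gcongr

theorem energy_zero_eq (G : 𝓢(EuclideanSpace ℝ (Fin d), ℂ)) :
    energy 0 G = ∫⁻ x, ‖G x‖ₑ ^ 2 := by
  have h := G.integral_norm_sq_fourier
  have key : ∀ H : 𝓢(EuclideanSpace ℝ (Fin d), ℂ),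
      ∫⁻ x, ‖H x‖ₑ ^ 2 = ENNReal.ofReal (∫ x, ‖H x‖ ^ 2) := by
    intro H
    have hH : Integrable fun x => ‖H x‖ ^ 2 := (H.memLp 2 volume).integrable_norm_pow (by simp)
    rw [ofReal_integral_eq_lintegral_ofReal hH (ae_of_all _ fun x => by positivity)]
    refine lintegral_congr fun x => ?_
    rw [ENNReal.ofReal_pow (norm_nonneg _), ofReal_norm]
  rw [key G, ← h, ← key, energy]
  simp

theorem enorm_fourier_lineDerivOp_sq (G : 𝓢(EuclideanSpace ℝ (Fin d), ℂ))
    (v ξ : EuclideanSpace ℝ (Fin d)) : ‖𝓕 (∂_{v} G) ξ‖ₑ ^ 2 =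
      ENNReal.ofReal (4 * Real.pi ^ 2 * inner ℝ ξ v ^ 2) * ‖𝓕 G ξ‖ₑ ^ 2 := by
  have e : 𝓕 (∂_{v} G) ξ = (2 * Real.pi * Complex.I) * (inner ℝ ξ v * 𝓕 G ξ) := by
    rw [SchwartzMap.fourier_lineDerivOp_eq]
    change (2 * Real.pi * Complex.I) *
      (SchwartzMap.smulLeftCLM ℂ (fun x => inner ℝ x v) (𝓕 G)) ξ = _
    rw [SchwartzMap.smulLeftCLM_apply_apply (by fun_prop), Complex.real_smul]
  have h : 4 * Real.pi ^ 2 * inner ℝ ξ v ^ 2 = ‖2 * Real.pi * Complex.I * (inner ℝ ξ v : ℂ)‖ ^ 2 := by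
    simp [mul_pow]
    norm_num
  rw [e, ← mul_assoc, enorm_mul, mul_pow, h, ENNReal.ofReal_pow (norm_nonneg _),
    ofReal_norm]

theorem energy_neg_one_lineDerivOp_le (G : 𝓢(EuclideanSpace ℝ (Fin d), ℂ)) (j : Fin d) :
    energy (-1) (∂_{EuclideanSpace.single j (1 : ℝ)} G) ≤
      ENNReal.ofReal (4 * Real.pi ^ 2) * energy 0 G := by
  rw [energy, energy, ← lintegral_const_mul _ (measurable_energy_integrand 0 G)]
  refine lintegral_mono fun ξ => ?_
  change _ * ‖𝓕 (∂_{EuclideanSpace.single j (1 : ℝ)} G) ξ‖ₑ ^ 2 ≤ _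
  rw [enorm_fourier_lineDerivOp_sq, ← mul_assoc, ← mul_assoc,
    ← ENNReal.ofReal_mul (by positivity), ← ENNReal.ofReal_mul (by positivity)]
  refine mul_le_mul_left (ENNReal.ofReal_le_ofReal ?_) _
  have h1 : |inner ℝ ξ (EuclideanSpace.single j (1 : ℝ))| ≤ ‖ξ‖ := by
    simpa using abs_real_inner_le_norm ξ (EuclideanSpace.single j (1 : ℝ))
  have h2 : inner ℝ ξ (EuclideanSpace.single j (1 : ℝ)) ^ 2 ≤ ‖ξ‖ ^ 2 :=
    sq_le_sq.2 (by rwa [abs_norm])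
  have hX : (0 : ℝ) < 1 + ‖ξ‖ ^ 2 := by positivity
  rw [Real.rpow_neg_one, Real.rpow_zero, mul_one, inv_mul_le_iff₀ hX]
  nlinarith [sq_nonneg Real.pi, mul_le_mul_of_nonneg_left h2 (sq_nonneg Real.pi)]

/-- Pointwise in frequency, `1 + ‖ξ‖² ≤ 1 + 4π² ∑ ξ_j²`, and `4π² ξ_j²` is the multiplier of the
`j`-th derivative. -/
theorem energy_add_one_le (t : ℝ) (G : 𝓢(EuclideanSpace ℝ (Fin d), ℂ)) :
    energy (t + 1) G ≤
      energy t G + ∑ j : Fin d, energy t (∂_{EuclideanSpace.single j (1 : ℝ)} G) := by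
  simp_rw [energy]
  rw [← lintegral_finsetSum _ fun j _ => measurable_energy_integrand t _,
    ← lintegral_add_left (measurable_energy_integrand t G)]
  refine lintegral_mono fun ξ => ?_
  change _ ≤ _ + ∑ j : Fin d, ENNReal.ofReal ((1 + ‖ξ‖ ^ 2) ^ t) *
    ‖𝓕 (∂_{EuclideanSpace.single j (1 : ℝ)} G) ξ‖ₑ ^ 2
  simp_rw [enorm_fourier_lineDerivOp_sq, ← mul_assoc]
  rw [← Finset.sum_mul, ← Finset.mul_sum, ← add_mul]
  have hX : (0 : ℝ) < 1 + ‖ξ‖ ^ 2 := by positivity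
  gcongr
  rw [← ENNReal.ofReal_sum_of_nonneg fun j _ => by positivity,
    ← ENNReal.ofReal_mul (by positivity), ← ENNReal.ofReal_add (by positivity)
      (mul_nonneg (by positivity) (Finset.sum_nonneg fun j _ => by positivity))]
  refine ENNReal.ofReal_le_ofReal ?_
  rw [Real.rpow_add_one hX.ne', mul_add, mul_one, ← Finset.mul_sum]
  gcongr
  have e : ∑ j : Fin d, inner ℝ ξ (EuclideanSpace.single j (1 : ℝ)) ^ 2 = ‖ξ‖ ^ 2 := by
    rw [EuclideanSpace.real_norm_sq_eq]
    refine Finset.sum_congr rfl fun j _ => ?_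
    rw [EuclideanSpace.inner_single_right]
    simp
  rw [e]
  nlinarith [Real.pi_gt_three, sq_nonneg ‖ξ‖, mul_nonneg (sq_nonneg ‖ξ‖) (sq_nonneg (Real.pi - 1))]

/-- A sequence of Schwartz functions whose energies, multiplied by `4^{nκ}`, are summable. -/
def SummableEnergy (κ t : ℝ) (G : ℕ → 𝓢(EuclideanSpace ℝ (Fin d), ℂ)) : Prop :=
  ∑' n : ℕ, ENNReal.ofReal (4 ^ (n * κ)) * energy t (G n) ≠ ⊤

theorem SummableEnergy.of_le {κ t κ' t' : ℝ} {G G' : ℕ → 𝓢(EuclideanSpace ℝ (Fin d), ℂ)}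
    (h : SummableEnergy κ t G) {C : ℝ≥0∞} (hC : C ≠ ⊤)
    (hle : ∀ n : ℕ, ENNReal.ofReal (4 ^ (n * κ')) * energy t' (G' n) ≤
      C * (ENNReal.ofReal (4 ^ (n * κ)) * energy t (G n))) : SummableEnergy κ' t' G' := by
  refine ne_top_of_le_ne_top (ENNReal.mul_ne_top hC h) ?_
  rw [← ENNReal.tsum_mul_left]
  exact ENNReal.tsum_le_tsum hle

theorem SummableEnergy.add {κ t : ℝ} {G H : ℕ → 𝓢(EuclideanSpace ℝ (Fin d), ℂ)}
    (hG : SummableEnergy κ t G) (hH : SummableEnergy κ t H) :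
    SummableEnergy κ t (fun n => G n + H n) := by
  refine ne_top_of_le_ne_top (ENNReal.add_ne_top.2 ⟨ENNReal.mul_ne_top ENNReal.ofNat_ne_top hG,
    ENNReal.mul_ne_top ENNReal.ofNat_ne_top hH⟩ :
      (2 : ℝ≥0∞) * _ + (2 : ℝ≥0∞) * _ ≠ ⊤) ?_
  rw [← ENNReal.tsum_mul_left, ← ENNReal.tsum_mul_left, ← ENNReal.tsum_add]
  refine ENNReal.tsum_le_tsum fun n => ?_
  refine (mul_le_mul_right (energy_add_le _ _ _) _).trans (le_of_eq ?_)
  ring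

theorem SummableEnergy.smul {κ t : ℝ} {G : ℕ → 𝓢(EuclideanSpace ℝ (Fin d), ℂ)}
    (hG : SummableEnergy κ t G) (c : ℝ) : SummableEnergy κ t (fun n => c • G n) :=
  hG.of_le (C := ENNReal.ofReal (c ^ 2)) ENNReal.ofReal_ne_top fun n => by
    rw [energy_smul]
    exact le_of_eq (by ring)

theorem SummableEnergy.mono {κ κ' t t' : ℝ} {G : ℕ → 𝓢(EuclideanSpace ℝ (Fin d), ℂ)}
    (hG : SummableEnergy κ t G) (hκ : κ' ≤ κ) (ht : t' ≤ t) : SummableEnergy κ' t' G :=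
  hG.of_le (C := 1) ENNReal.one_ne_top fun n => by
    rw [one_mul]
    gcongr
    · norm_num
    · exact energy_mono ht _

theorem summableEnergy_zero (κ t : ℝ) :
    SummableEnergy κ t (fun _ => (0 : 𝓢(EuclideanSpace ℝ (Fin d), ℂ))) := by
  have h : energy t (0 : 𝓢(EuclideanSpace ℝ (Fin d), ℂ)) = 0 := by
    simpa using energy_smul t 0 (0 : 𝓢(EuclideanSpace ℝ (Fin d), ℂ))
  simp [SummableEnergy, h]

theorem SummableEnergy.sum {ι : Type*} {κ t : ℝ} (s : Finset ι)
    {G : ι → ℕ → 𝓢(EuclideanSpace ℝ (Fin d), ℂ)}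
    (hG : ∀ i ∈ s, SummableEnergy κ t (G i)) : SummableEnergy κ t (fun n => ∑ i ∈ s, G i n) := by
  classical
  induction s using Finset.induction_on with
  | empty => simpa using summableEnergy_zero κ t
  | insert i s hi ih =>
    simp_rw [Finset.sum_insert hi]
    exact (hG i (Finset.mem_insert_self i s)).add
      (ih fun j hj => hG j (Finset.mem_insert_of_mem hj))

/-- Energy is quadratic, so a factor `2^n` on the functions is worth one unit of `κ`. -/
theorem summableEnergy_two_pow_smul_iff {κ t : ℝ} {G : ℕ → 𝓢(EuclideanSpace ℝ (Fin d), ℂ)} :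
    SummableEnergy κ t (fun n => (2 : ℝ) ^ n • G n) ↔ SummableEnergy (κ + 1) t G := by
  have e : ∀ n : ℕ, ENNReal.ofReal (4 ^ (n * κ)) * energy t ((2 : ℝ) ^ n • G n) =
      ENNReal.ofReal (4 ^ (n * (κ + 1))) * energy t (G n) := by
    intro n
    rw [energy_smul, ← mul_assoc, ← ENNReal.ofReal_mul (by positivity)]
    congr 2
    rw [mul_add, mul_one, Real.rpow_add (by norm_num), Real.rpow_natCast, pow_right_comm]
    norm_num
  simp_rw [SummableEnergy, e]

theorem SummableEnergy.lineDerivOp {κ : ℝ} {G : ℕ → 𝓢(EuclideanSpace ℝ (Fin d), ℂ)}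
    (hG : SummableEnergy κ 0 G) (j : Fin d) :
    SummableEnergy κ (-1) (fun n => ∂_{EuclideanSpace.single j (1 : ℝ)} (G n)) :=
  hG.of_le (C := ENNReal.ofReal (4 * Real.pi ^ 2)) ENNReal.ofReal_ne_top fun n =>
    (mul_le_mul_right (energy_neg_one_lineDerivOp_le _ j) _).trans (le_of_eq (by ring))

theorem SummableEnergy.of_lineDerivOp {κ t : ℝ} {G : ℕ → 𝓢(EuclideanSpace ℝ (Fin d), ℂ)}
    (hG : SummableEnergy κ t G)
    (h : ∀ j : Fin d, SummableEnergy κ t (fun n => ∂_{EuclideanSpace.single j (1 : ℝ)} (G n))) :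
    SummableEnergy κ (t + 1) G := by
  refine ne_top_of_le_ne_top (ENNReal.add_ne_top.2 ⟨hG, ENNReal.sum_ne_top.2 fun j _ => h j⟩ :
    _ + ∑ j : Fin d, _ ≠ ⊤) ?_
  rw [← Summable.tsum_finsetSum fun j _ => ENNReal.summable, ← ENNReal.tsum_add]
  refine ENNReal.tsum_le_tsum fun n => ?_
  rw [← Finset.mul_sum, ← mul_add]
  exact mul_le_mul_right (energy_add_one_le _ _) _

/-- By Plancherel the energy at `t = 0` is the `L²` norm, and the bounded cutoff restricts it to the
compact set `tsupport φ`. -/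
theorem SquareDecay.summableEnergy_zero {f : 𝓓'(whole d, ℂ)} {m : ℕ} {σ : ℝ}
    (hf : SquareDecay f m σ) (φ : 𝓓(whole d, ℂ)) {ψ : 𝓓(whole d, ℝ)} (hψ : ψ ∈ vanishing d m) :
    SummableEnergy σ 0 (fun n => piece f φ n ψ) := by
  obtain ⟨M, hM⟩ := φ.hasCompactSupport.exists_bound_of_continuous φ.continuous
  have h := hf (tsupport φ) φ.hasCompactSupport ψ hψ
  refine ne_top_of_le_ne_top (ENNReal.mul_ne_top (a := ENNReal.ofReal M ^ 2)
    (ENNReal.pow_ne_top ENNReal.ofReal_ne_top) h) ?_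
  rw [← ENNReal.tsum_mul_left]
  refine ENNReal.tsum_le_tsum fun n => ?_
  rw [mul_left_comm]
  refine mul_le_mul_right ?_ _
  have hm : Measurable fun x => ‖f (rescale n x ψ)‖ₑ ^ 2 :=
    (contDiff_apply_rescale f n ψ).continuous.measurable.enorm.pow_const 2
  rw [energy_zero_eq, ← lintegral_const_mul _ hm,
    ← lintegral_indicator (isClosed_tsupport _).measurableSet]
  refine lintegral_mono fun x => ?_
  change ‖φ x * f (rescale n x ψ)‖ₑ ^ 2 ≤ _
  by_cases hx : x ∈ tsupport φ
  · rw [indicator_of_mem hx, enorm_mul, mul_pow]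
    gcongr
    rw [← ofReal_norm]
    exact ENNReal.ofReal_le_ofReal (hM x)
  · simp [image_eq_zero_of_notMem_tsupport hx]

/-- The high-regularity bound: each derivative lands on `φ` for free or on `ψ` at the price `2^n`.
Both functions change under the Leibniz rule, so the induction generalizes over both. -/
theorem SquareDecay.summableEnergy_natCast {f : 𝓓'(whole d, ℂ)} {m : ℕ} {σ : ℝ}
    (hf : SquareDecay f m σ) (N : ℕ) (φ : 𝓓(whole d, ℂ)) {ψ : 𝓓(whole d, ℝ)}
    (hψ : ψ ∈ vanishing d m) : SummableEnergy (σ - N) N (fun n => piece f φ n ψ) := by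
  induction N generalizing φ ψ with
  | zero => simpa using hf.summableEnergy_zero φ hψ
  | succ N ih =>
    push_cast
    refine SummableEnergy.of_lineDerivOp ((ih φ hψ).mono (by linarith) le_rfl) fun j => ?_
    simp_rw [lineDerivOp_piece]
    refine ((ih _ hψ).mono (by linarith) le_rfl).add (summableEnergy_two_pow_smul_iff.2 ?_)
    have := ih φ (lineDerivOp_mem_vanishing hψ j)
    rwa [show σ - (N + 1) + 1 = σ - (N : ℝ) by ring]

theorem piece_sum {ι : Type*} (f : 𝓓'(whole d, ℂ)) (φ : 𝓓(whole d, ℂ)) (n : ℕ) (s : Finset ι)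
    (ψ : ι → 𝓓(whole d, ℝ)) : piece f φ n (∑ i ∈ s, ψ i) = ∑ i ∈ s, piece f φ n (ψ i) := by
  ext x
  have e : rescale n x (∑ i ∈ s, ψ i) = ∑ i ∈ s, rescale n x (ψ i) := by
    have : ∀ θ : 𝓓(whole d, ℝ), rescale n x θ = (AddMonoidHom.mk' (rescale n x) (by
        intro a b
        ext y
        exact mul_add _ _ _)) θ := fun _ => rfl
    rw [this, map_sum]
    rfl
  rw [sum_apply, piece_apply, e, map_sum, Finset.mul_sum]
  rfl

/-- The low-regularity bound: the Leibniz rule is read backwards. Up to a commutator with `∂φ`,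
`2^n` times a piece built from `∂η` is a derivative of the piece built from `η`, and a derivative
maps `L²` to `H^{-1}`. -/
theorem SquareDecay.summableEnergy_neg_one {f : 𝓓'(whole d, ℂ)} {m : ℕ} {σ : ℝ}
    (hf : SquareDecay f m σ) (φ : 𝓓(whole d, ℂ)) {η : Fin d → 𝓓(whole d, ℝ)}
    (hη : ∀ j, η j ∈ vanishing d m) : SummableEnergy (σ + 1) (-1)
      (fun n => piece f φ n (∑ j, ∂_{EuclideanSpace.single j (1 : ℝ)} (η j))) := by
  simp_rw [piece_sum]
  refine SummableEnergy.sum _ fun j _ => summableEnergy_two_pow_smul_iff.1 ?_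
  have e : ∀ n, (2 : ℝ) ^ n • piece f φ n (∂_{EuclideanSpace.single j (1 : ℝ)} (η j)) =
      ∂_{EuclideanSpace.single j (1 : ℝ)} (piece f φ n (η j)) +
        (-1 : ℝ) • piece f (∂_{EuclideanSpace.single j (1 : ℝ)} φ) n (η j) := by
    intro n
    rw [lineDerivOp_piece, neg_one_smul]
    abel
  simp_rw [e]
  exact ((hf.summableEnergy_zero φ (hη j)).lineDerivOp j).add
    (((hf.summableEnergy_zero _ (hη j)).mono le_rfl (by norm_num)).smul _)

/-! ### Almost orthogonality across scales -/

/-- The weight `X^σ / (4^{n(σ+1)} X⁻¹ + 4^{n(σ-N)} X^N)`, which peaks at `X = 4^n`. -/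
def peak (σ N : ℝ) (n : ℕ) (X : ℝ) : ℝ :=
  X ^ σ / (4 ^ (n * (σ + 1)) * X ^ (-1 : ℝ) + 4 ^ (n * (σ - N)) * X ^ N)

theorem peak_le_left (σ N : ℝ) (n : ℕ) {X : ℝ} (hX : 0 < X) :
    peak σ N n X ≤ 4 ^ (-(n * (σ + 1))) * X ^ (σ + 1) := by
  have h4 : ∀ t : ℝ, (0 : ℝ) < 4 ^ t := fun t => Real.rpow_pos_of_pos (by norm_num) t
  have hXt : ∀ t : ℝ, 0 < X ^ t := fun t => Real.rpow_pos_of_pos hX t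
  have : peak σ N n X ≤ X ^ σ / (4 ^ (n * (σ + 1)) * X ^ (-1 : ℝ)) :=
    div_le_div_of_nonneg_left (hXt _).le (mul_pos (h4 _) (hXt _))
      (le_add_of_nonneg_right (mul_pos (h4 _) (hXt _)).le)
  refine this.trans (le_of_eq ?_)
  rw [Real.rpow_neg (by norm_num) (n * (σ + 1)), Real.rpow_add hX, Real.rpow_one,
    Real.rpow_neg_one]
  have := (h4 (n * (σ + 1))).ne'
  field_simp

theorem peak_le_right (σ N : ℝ) (n : ℕ) {X : ℝ} (hX : 0 < X) :
    peak σ N n X ≤ 4 ^ (n * (N - σ)) * X ^ (σ - N) := by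
  have h4 : ∀ t : ℝ, (0 : ℝ) < 4 ^ t := fun t => Real.rpow_pos_of_pos (by norm_num) t
  have hXt : ∀ t : ℝ, 0 < X ^ t := fun t => Real.rpow_pos_of_pos hX t
  have : peak σ N n X ≤ X ^ σ / (4 ^ (n * (σ - N)) * X ^ N) :=
    div_le_div_of_nonneg_left (hXt _).le (mul_pos (h4 _) (hXt _))
      (le_add_of_nonneg_left (mul_pos (h4 _) (hXt _)).le)
  refine this.trans (le_of_eq ?_)
  rw [Real.rpow_sub hX, show (n : ℝ) * (N - σ) = -(n * (σ - N)) by ring,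
    Real.rpow_neg (by norm_num)]
  have := (h4 (n * (σ - N))).ne'
  have := (hXt N).ne'
  field_simp

theorem sum_range_peak_le {σ N : ℝ} (hN : σ < N) {X : ℝ} {k : ℕ} (hk : (4 : ℝ) ^ k ≤ X) :
    ∑ n ∈ Finset.range (k + 1), ENNReal.ofReal (peak σ N n X) ≤
      (1 - ENNReal.ofReal (4 ^ (σ - N)))⁻¹ := by
  have h4 : ∀ t : ℝ, (0 : ℝ) < 4 ^ t := fun t => Real.rpow_pos_of_pos (by norm_num) t
  have hX0 : 0 < X := (by positivity : (0 : ℝ) < 4 ^ k).trans_le hk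
  rw [← ENNReal.tsum_geometric]
  refine le_trans ?_ (ENNReal.sum_le_tsum (Finset.range (k + 1)))
  -- Counting downwards from `k` turns the growing terms into a decaying geometric series.
  rw [← Finset.sum_range_reflect]
  refine Finset.sum_le_sum fun n hn => ?_
  have hnk : n ≤ k := Nat.lt_succ_iff.1 (Finset.mem_range.1 hn)
  rw [← ENNReal.ofReal_pow (h4 _).le, Nat.add_sub_cancel]
  refine ENNReal.ofReal_le_ofReal ((peak_le_right σ N _ hX0).trans ?_)
  have e : X ^ (σ - N) ≤ 4 ^ (k * (σ - N)) := by
    rw [Real.rpow_mul (by norm_num), Real.rpow_natCast]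
    exact Real.rpow_le_rpow_of_nonpos (by positivity) hk (by linarith)
  refine (mul_le_mul_of_nonneg_left e (h4 _).le).trans (le_of_eq ?_)
  rw [← Real.rpow_add (by norm_num), ← Real.rpow_mul_natCast (by norm_num),
    Nat.cast_sub hnk]
  congr 1
  ring

theorem tsum_peak_add_le {σ : ℝ} (N : ℝ) (hσ : -1 < σ) {X : ℝ} (hX : 0 < X) {k : ℕ}
    (hk : X ≤ (4 : ℝ) ^ k) : ∑' n : ℕ, ENNReal.ofReal (peak σ N (n + k) X) ≤
      (1 - ENNReal.ofReal (4 ^ (-(σ + 1))))⁻¹ := by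
  have h4 : ∀ t : ℝ, (0 : ℝ) < 4 ^ t := fun t => Real.rpow_pos_of_pos (by norm_num) t
  rw [← ENNReal.tsum_geometric]
  refine ENNReal.tsum_le_tsum fun n => ?_
  rw [← ENNReal.ofReal_pow (h4 _).le]
  refine ENNReal.ofReal_le_ofReal ((peak_le_left σ N _ hX).trans ?_)
  have e : X ^ (σ + 1) ≤ 4 ^ (k * (σ + 1)) := by
    rw [Real.rpow_mul (by norm_num), Real.rpow_natCast]
    exact Real.rpow_le_rpow hX.le hk (by linarith)
  refine (mul_le_mul_of_nonneg_left e (h4 _).le).trans (le_of_eq ?_)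
  rw [← Real.rpow_add (by norm_num), ← Real.rpow_mul_natCast (by norm_num)]
  congr 1
  push_cast
  ring

/-- Split at the scale with `4^k ≤ X < 4^(k+1)`. Below it the `X^N` term of the denominator gives
geometric decay because `σ < N`; above it the `X⁻¹` term does because `-1 < σ`. The bound is
independent of `X`. -/
theorem tsum_peak_le {σ N : ℝ} (hσ : -1 < σ) (hN : σ < N) {X : ℝ} (hX : 1 ≤ X) :
    ∑' n : ℕ, ENNReal.ofReal (peak σ N n X) ≤
      (1 - ENNReal.ofReal (4 ^ (σ - N)))⁻¹ + (1 - ENNReal.ofReal (4 ^ (-(σ + 1))))⁻¹ := by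
  have h4 : (1 : ℝ) < 4 := by norm_num
  obtain ⟨k, hk1, hk2⟩ : ∃ k : ℕ, (4 : ℝ) ^ k ≤ X ∧ X < 4 ^ (k + 1) := exists_nat_pow_near hX h4
  refine (ENNReal.summable.sum_add_tsum_nat_add' (k := k + 1)).symm.le.trans ?_
  refine add_le_add ?_ ?_
  · exact sum_range_peak_le hN hk1
  · exact tsum_peak_add_le N hσ (zero_lt_one.trans_le hX) hk2.le

theorem exists_tsum_peak_le {σ N : ℝ} (hσ : -1 < σ) (hN : σ < N) :
    ∃ D : ℝ≥0∞, D ≠ ⊤ ∧ ∀ X : ℝ, 1 ≤ X → ∑' n : ℕ, ENNReal.ofReal (peak σ N n X) ≤ D := by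
  have h : ∀ t : ℝ, t < 0 → (1 - ENNReal.ofReal (4 ^ t))⁻¹ ≠ ⊤ := fun t ht =>
    ENNReal.inv_ne_top.2 (tsub_pos_of_lt (ENNReal.ofReal_lt_one.2
      (Real.rpow_lt_one_of_one_lt_of_neg (by norm_num) ht))).ne'
  exact ⟨_, ENNReal.add_ne_top.2 ⟨h _ (by linarith), h _ (by linarith)⟩,
    fun X hX => tsum_peak_le hσ hN hX⟩

theorem mul_mul_le_weighted_sq (u v : ℂ) {w a : ℝ} (hw : 0 ≤ w) (ha : 0 < a) :
    ‖u‖ₑ * (ENNReal.ofReal w * ‖v‖ₑ) ≤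
      ENNReal.ofReal a * ‖u‖ₑ ^ 2 + ENNReal.ofReal (w ^ 2 / a) * ‖v‖ₑ ^ 2 := by
  simp_rw [← ofReal_norm]
  rw [← ENNReal.ofReal_mul hw, ← ENNReal.ofReal_mul (norm_nonneg _),
    ← ENNReal.ofReal_pow (norm_nonneg _), ← ENNReal.ofReal_pow (norm_nonneg _),
    ← ENNReal.ofReal_mul ha.le, ← ENNReal.ofReal_mul (by positivity),
    ← ENNReal.ofReal_add (by positivity) (by positivity)]
  refine ENNReal.ofReal_le_ofReal ?_
  have e : a * ‖u‖ ^ 2 + w ^ 2 / a * ‖v‖ ^ 2 - ‖u‖ * (w * ‖v‖) =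
      ((a * ‖u‖ - w * ‖v‖) ^ 2 + (a * ‖u‖) * (w * ‖v‖)) / a := by
    field_simp
    ring
  have : 0 ≤ ((a * ‖u‖ - w * ‖v‖) ^ 2 + (a * ‖u‖) * (w * ‖v‖)) / a := by positivity
  linarith

/-- Weighted Young inequality at each frequency and scale. The weight `a n` is chosen so that the
terms in `G n` add up to the two energy sums, while the remaining multiplier of `‖g‖²` is exactly
`peak`, which sums to at most `D`. -/
theorem tsum_lintegral_fourier_mul_le {σ : ℝ} (hσ : -1 < σ) {N : ℕ} (hN : σ < N)
    {G : ℕ → 𝓢(EuclideanSpace ℝ (Fin d), ℂ)} (h1 : SummableEnergy (σ + 1) (-1) G)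
    (h2 : SummableEnergy (σ - N) N G) : ∃ A B : ℝ≥0∞, A ≠ ⊤ ∧ B ≠ ⊤ ∧
      ∀ g : 𝓢(EuclideanSpace ℝ (Fin d), ℂ), ∑' n, ∫⁻ ξ, ‖𝓕 (G n) ξ‖ₑ *
        (ENNReal.ofReal ((1 + ‖ξ‖ ^ 2) ^ (σ / 2)) * ‖g ξ‖ₑ) ≤ A + B * ∫⁻ ξ, ‖g ξ‖ₑ ^ 2 := by
  obtain ⟨D, hD, hDle⟩ := exists_tsum_peak_le hσ hN
  refine ⟨_, D, ENNReal.add_ne_top.2 ⟨h1, h2⟩, hD, fun g => ?_⟩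
  have hg : Measurable fun ξ => ‖g ξ‖ₑ ^ 2 := g.continuous.measurable.enorm.pow_const 2
  set a : ℕ → EuclideanSpace ℝ (Fin d) → ℝ := fun n ξ =>
    4 ^ (n * (σ + 1)) * (1 + ‖ξ‖ ^ 2) ^ (-1 : ℝ) + 4 ^ (n * (σ - N)) * (1 + ‖ξ‖ ^ 2) ^ (N : ℝ)
  have ha : ∀ n ξ, 0 < a n ξ := fun n ξ => by positivity
  have ham : ∀ n, Measurable (a n) := fun n => by fun_prop
  have hm1 : ∀ n, Measurable fun ξ => ENNReal.ofReal (a n ξ) * ‖𝓕 (G n) ξ‖ₑ ^ 2 := fun n =>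
    (ham n).ennreal_ofReal.mul ((𝓕 (G n)).continuous.measurable.enorm.pow_const 2)
  have hm2 : ∀ n, Measurable fun ξ : EuclideanSpace ℝ (Fin d) =>
      ENNReal.ofReal ((1 + ‖ξ‖ ^ 2) ^ σ / a n ξ) := fun n =>
    Measurable.ennreal_ofReal (Measurable.div (by fun_prop) (ham n))
  calc _ ≤ ∑' n, ((∫⁻ ξ, ENNReal.ofReal (a n ξ) * ‖𝓕 (G n) ξ‖ₑ ^ 2) +
        ∫⁻ ξ, ENNReal.ofReal ((1 + ‖ξ‖ ^ 2) ^ σ / a n ξ) * ‖g ξ‖ₑ ^ 2) := by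
        refine ENNReal.tsum_le_tsum fun n => ?_
        rw [← lintegral_add_left (hm1 n)]
        refine lintegral_mono fun ξ => ?_
        have e : (1 + ‖ξ‖ ^ 2) ^ σ = ((1 + ‖ξ‖ ^ 2) ^ (σ / 2)) ^ 2 := by
          rw [← Real.rpow_mul_natCast (by positivity)]
          congr 1
          push_cast
          ring
        have := mul_mul_le_weighted_sq (𝓕 (G n) ξ) (g ξ)
          (w := (1 + ‖ξ‖ ^ 2) ^ (σ / 2)) (by positivity) (ha n ξ)
        rwa [← e] at this
    _ ≤ _ := by
        rw [ENNReal.tsum_add]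
        refine add_le_add ?_ ?_
        · rw [← ENNReal.tsum_add]
          refine ENNReal.tsum_le_tsum fun n => le_of_eq ?_
          rw [energy, energy, ← lintegral_const_mul _ (measurable_energy_integrand _ _),
            ← lintegral_const_mul _ (measurable_energy_integrand _ _),
            ← lintegral_add_left ((measurable_energy_integrand _ _).const_mul _)]
          refine lintegral_congr fun ξ => ?_
          rw [ENNReal.ofReal_add (by positivity) (by positivity),
            ENNReal.ofReal_mul (by positivity), ENNReal.ofReal_mul (by positivity), add_mul,
            mul_assoc, mul_assoc]
        · rw [← lintegral_const_mul _ hg, ← lintegral_tsum]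
          swap
          · exact fun n => ((hm2 n).mul hg).aemeasurable
          refine lintegral_mono fun ξ => ?_
          rw [ENNReal.tsum_mul_right]
          exact mul_le_mul_left (hDle _ (by linarith [sq_nonneg ‖ξ‖])) _

/-! ### The localized distribution as a functional on the Fourier side -/

theorem tendsto_integral_mul_apply_rescale (f : 𝓓'(whole d, ℂ)) (Θ : 𝓓(whole d, ℂ))
    (ρ : 𝓓(whole d, ℝ)) (hρ : ∫ x, ρ x = 1) :
    Tendsto (fun n : ℕ => ∫ x, Θ x * f (rescale n x ρ)) atTop (𝓝 (complexApply f Θ)) := by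
  set θr : 𝓓(whole d, ℝ) := TestFunction.postcompCLM (𝕜 := ℝ) Complex.reCLM Θ
  set θi : 𝓓(whole d, ℝ) := TestFunction.postcompCLM (𝕜 := ℝ) Complex.imCLM Θ
  have hr : ∀ x, θr x = (Θ x).re := fun x => rfl
  have hi : ∀ x, θi x = (Θ x).im := fun x => rfl
  have hint : ∀ (θ : 𝓓(whole d, ℝ)) (n : ℕ), Integrable fun x => θ x • f (rescale n x ρ) :=
    fun θ n => (θ.continuous.smul (contDiff_apply_rescale f n ρ).continuous)
      |>.integrable_of_hasCompactSupport θ.hasCompactSupport.smul_right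
  have e : ∀ n : ℕ, ∫ x, Θ x * f (rescale n x ρ) = (∫ x, θr x • f (rescale n x ρ)) +
      Complex.I * ∫ x, θi x • f (rescale n x ρ) := by
    intro n
    rw [← integral_const_mul, ← integral_add (hint θr n) ((hint θi n).const_mul _)]
    refine integral_congr_ae (ae_of_all _ fun x => ?_)
    change Θ x * f (rescale n x ρ) =
      (Θ x).re • f (rescale n x ρ) + Complex.I * ((Θ x).im • f (rescale n x ρ))
    rw [Complex.real_smul, Complex.real_smul]
    conv_lhs => rw [← Complex.re_add_im (Θ x)]
    ring
  simp_rw [e]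
  exact (tendsto_integral_smul_apply_rescale f θr ρ hρ).add
    ((tendsto_integral_smul_apply_rescale f θi ρ hρ).const_mul _)

theorem complexApply_add (f : 𝓓'(whole d, ℂ)) (Θ Φ : 𝓓(whole d, ℂ)) :
    complexApply f (Θ + Φ) = complexApply f Θ + complexApply f Φ := by
  simp only [complexApply, map_add]
  ring

theorem complexApply_smul (f : 𝓓'(whole d, ℂ)) (c : ℂ) (Θ : 𝓓(whole d, ℂ)) :
    complexApply f (c • Θ) = c * complexApply f Θ := by
  have e1 : TestFunction.postcompCLM (𝕜 := ℝ) Complex.reCLM (c • Θ) =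
      c.re • TestFunction.postcompCLM (𝕜 := ℝ) Complex.reCLM Θ -
        c.im • TestFunction.postcompCLM (𝕜 := ℝ) Complex.imCLM Θ := by
    ext x
    exact Complex.mul_re c (Θ x)
  have e2 : TestFunction.postcompCLM (𝕜 := ℝ) Complex.imCLM (c • Θ) =
      c.re • TestFunction.postcompCLM (𝕜 := ℝ) Complex.imCLM Θ +
        c.im • TestFunction.postcompCLM (𝕜 := ℝ) Complex.reCLM Θ := by
    ext x
    exact Complex.mul_im c (Θ x)
  rw [complexApply, complexApply, e1, e2, map_sub, map_add, map_smul, map_smul, map_smul, map_smul]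
  simp only [Complex.real_smul]
  conv_rhs => rw [← Complex.re_add_im c]
  linear_combination (-(c.im : ℂ) * f (TestFunction.postcompCLM (𝕜 := ℝ) Complex.imCLM Θ)) *
    Complex.I_mul_I

/-- Multiplication of Schwartz functions by `(1 + ‖ξ‖²)^{s/2}`. -/
def weightCLM (s : ℝ) :
    𝓢(EuclideanSpace ℝ (Fin d), ℂ) →L[ℂ] 𝓢(EuclideanSpace ℝ (Fin d), ℂ) :=
  SchwartzMap.smulLeftCLM ℂ (fun x => (((1 + ‖x‖ ^ 2) ^ (s / 2) : ℝ) : ℂ))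

theorem weightCLM_apply (s : ℝ) (g : 𝓢(EuclideanSpace ℝ (Fin d), ℂ))
    (x : EuclideanSpace ℝ (Fin d)) :
    weightCLM s g x = (((1 + ‖x‖ ^ 2) ^ (s / 2) : ℝ) : ℂ) * g x :=
  SchwartzMap.smulLeftCLM_apply_apply (by fun_prop) g x

theorem weightCLM_weightCLM_neg (s : ℝ) (g : 𝓢(EuclideanSpace ℝ (Fin d), ℂ)) :
    weightCLM s (weightCLM (-s) g) = g := by
  ext x
  rw [weightCLM_apply, weightCLM_apply, ← mul_assoc, ← Complex.ofReal_mul,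
    ← Real.rpow_add (by positivity), show s / 2 + -s / 2 = 0 by ring, Real.rpow_zero,
    Complex.ofReal_one, one_mul]

/-- The functional `g ↦ f(φ 𝓕((1 + ‖ξ‖²)^{s/2} g))`. -/
def weightedPairing (f : 𝓓'(whole d, ℂ)) (φ : 𝓓(whole d, ℂ)) (s : ℝ) :
    𝓢(EuclideanSpace ℝ (Fin d), ℂ) →ₗ[ℂ] ℂ where
  toFun g := complexApply f (mulSchwartz φ (𝓕 (weightCLM s g)))
  map_add' g h := by
    rw [map_add, FourierTransform.fourier_add, ← complexApply_add]
    congr 1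
    ext x
    exact mul_add _ _ _
  map_smul' c g := by
    rw [map_smul, FourierTransform.fourier_smul, RingHom.id_apply, smul_eq_mul,
      ← complexApply_smul]
    congr 1
    ext x
    exact mul_left_comm _ _ _

theorem weightedPairing_apply (f : 𝓓'(whole d, ℂ)) (φ : 𝓓(whole d, ℂ)) (s : ℝ)
    (g : 𝓢(EuclideanSpace ℝ (Fin d), ℂ)) :
    weightedPairing f φ s g = complexApply f (mulSchwartz φ (𝓕 (weightCLM s g))) := rfl

/-- The Fourier transform is symmetric for the bilinear pairing, so it can be moved from the
weighted test function to the piece. -/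
theorem integral_mulSchwartz_mul_apply_rescale (f : 𝓓'(whole d, ℂ)) (φ : 𝓓(whole d, ℂ)) (s : ℝ)
    (g : 𝓢(EuclideanSpace ℝ (Fin d), ℂ)) (n : ℕ) (ρ : 𝓓(whole d, ℝ)) :
    ∫ x, mulSchwartz φ (𝓕 (weightCLM s g)) x * f (rescale n x ρ) =
      ∫ ξ, 𝓕 (piece f φ n ρ) ξ * weightCLM s g ξ := by
  rw [SchwartzMap.integral_fourier_mul_eq]
  refine integral_congr_ae (ae_of_all _ fun x => ?_)
  exact mul_right_comm _ _ _

theorem enorm_integral_fourier_mul_le (s : ℝ) (G g : 𝓢(EuclideanSpace ℝ (Fin d), ℂ)) :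
    ‖∫ ξ, 𝓕 G ξ * weightCLM s g ξ‖ₑ ≤
      ∫⁻ ξ, ‖𝓕 G ξ‖ₑ * (ENNReal.ofReal ((1 + ‖ξ‖ ^ 2) ^ (s / 2)) * ‖g ξ‖ₑ) := by
  refine (enorm_integral_le_lintegral_enorm _).trans (lintegral_mono fun ξ => le_of_eq ?_)
  change ‖𝓕 G ξ * weightCLM s g ξ‖ₑ = _
  rw [enorm_mul, weightCLM_apply, enorm_mul, ← ofReal_norm (Complex.ofReal _),
    Complex.norm_of_nonneg (by positivity)]

theorem piece_succ {f : 𝓓'(whole d, ℂ)} {φ : 𝓓(whole d, ℂ)} {ρ ψ : 𝓓(whole d, ℝ)}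
    (h : ∀ x, ψ x = 2 ^ d * ρ ((2 : ℝ) • x) - ρ x) (n : ℕ) :
    piece f φ (n + 1) ρ = piece f φ n ρ + piece f φ n ψ := by
  ext x
  change φ x * f (rescale (n + 1) x ρ) = φ x * f (rescale n x ρ) + φ x * f (rescale n x ψ)
  have e : rescale (n + 1) x ρ = rescale n x ρ + rescale n x ψ := by
    ext y
    change ((2 : ℝ) ^ (n + 1)) ^ d * ρ ((2 : ℝ) ^ (n + 1) • (x - y)) =
      ((2 : ℝ) ^ n) ^ d * ρ ((2 : ℝ) ^ n • (x - y)) +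
        ((2 : ℝ) ^ n) ^ d * ψ ((2 : ℝ) ^ n • (x - y))
    rw [h, smul_smul, ← pow_succ', pow_succ, mul_pow]
    ring
  rw [e, map_add, mul_add]

theorem piece_eq_add_sum {f : 𝓓'(whole d, ℂ)} {φ : 𝓓(whole d, ℂ)} {ρ ψ : 𝓓(whole d, ℝ)}
    (h : ∀ x, ψ x = 2 ^ d * ρ ((2 : ℝ) • x) - ρ x) (n : ℕ) :
    piece f φ n ρ = piece f φ 0 ρ + ∑ k ∈ Finset.range n, piece f φ k ψ := by
  induction n with
  | zero => simp
  | succ n ih => rw [piece_succ h, ih, Finset.sum_range_succ, add_assoc]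

theorem integrable_fourier_mul (s : ℝ) (G g : 𝓢(EuclideanSpace ℝ (Fin d), ℂ)) :
    Integrable fun ξ => 𝓕 G ξ * weightCLM s g ξ :=
  MemLp.integrable_mul (p := 2) (q := 2) ((𝓕 G).memLp 2 volume) ((weightCLM s g).memLp 2 volume)

/-- The functional `G ↦ ∫ 𝓕 G ξ (1 + ‖ξ‖²)^{s/2} g(ξ) dξ`. -/
def fourierPairing (s : ℝ) (g : 𝓢(EuclideanSpace ℝ (Fin d), ℂ)) :
    𝓢(EuclideanSpace ℝ (Fin d), ℂ) →+ ℂ :=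
  AddMonoidHom.mk' (fun G => ∫ ξ, 𝓕 G ξ * weightCLM s g ξ) fun G H => by
    rw [← integral_add (integrable_fourier_mul s G g) (integrable_fourier_mul s H g),
      FourierTransform.fourier_add]
    exact integral_congr_ae (ae_of_all _ fun ξ => add_mul _ _ _)

theorem energy_ne_top (t : ℝ) (G : 𝓢(EuclideanSpace ℝ (Fin d), ℂ)) : energy t G ≠ ⊤ := by
  have h := (weightCLM t (𝓕 G)).memLp 2 volume
  have h2 := eLpNorm_nnreal_pow_eq_lintegral (μ := volume) (f := weightCLM t (𝓕 G))
    (p := 2) (by simp)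
  norm_num at h2
  have h3 := ENNReal.pow_ne_top (n := 2) h.2.ne
  rw [h2] at h3
  refine ne_top_of_le_ne_top h3 (lintegral_mono fun ξ => le_of_eq ?_)
  change _ = ‖weightCLM t (𝓕 G) ξ‖ₑ ^ 2
  rw [weightCLM_apply, enorm_mul, mul_pow, ← ofReal_norm (Complex.ofReal _),
    Complex.norm_of_nonneg (by positivity), ← ENNReal.ofReal_pow (by positivity),
    ← Real.rpow_mul_natCast (by positivity)]
  congr 4
  push_cast
  ring

/-- The pairing is the limit of pairings with mollifications, each of which telescopes into the
coarse piece and finitely many fine pieces. The bound on the full series is uniform in the number of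
pieces and passes to the limit. -/
theorem exists_enorm_weightedPairing_le {f : 𝓓'(whole d, ℂ)} {m : ℕ} {σ : ℝ} (hσ : -1 < σ)
    (hf : SquareDecay f m σ) (φ : 𝓓(whole d, ℂ)) : ∃ A B : ℝ≥0∞, A ≠ ⊤ ∧ B ≠ ⊤ ∧
      ∀ g, ‖weightedPairing f φ σ g‖ₑ ≤ A + B * ∫⁻ ξ, ‖g ξ‖ₑ ^ 2 := by
  obtain ⟨ρ, ψ, η, hρ, hψρ, hψη, hψ, hη⟩ := exists_mollifier d m
  obtain ⟨N, hN⟩ := exists_nat_gt σ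
  have h1 := hf.summableEnergy_neg_one φ hη
  rw [← hψη] at h1
  obtain ⟨A, B, hA, hB, hAB⟩ := tsum_lintegral_fourier_mul_le hσ hN h1
    (hf.summableEnergy_natCast N φ hψ)
  refine ⟨energy σ (piece f φ 0 ρ) + A, 1 + B,
    ENNReal.add_ne_top.2 ⟨energy_ne_top _ _, hA⟩, ENNReal.add_ne_top.2 ⟨ENNReal.one_ne_top, hB⟩,
    fun g => ?_⟩
  have hlim := tendsto_integral_mul_apply_rescale f (mulSchwartz φ (𝓕 (weightCLM σ g))) ρ hρ
  rw [← weightedPairing_apply] at hlim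
  refine le_of_tendsto hlim.enorm (Eventually.of_forall fun k => ?_)
  rw [integral_mulSchwartz_mul_apply_rescale, piece_eq_add_sum hψρ]
  change ‖fourierPairing σ g _‖ₑ ≤ _
  rw [map_add, map_sum]
  -- The coarse piece is Schwartz, so its `H^σ` energy is finite without any moment condition on
  -- `ρ`. The Young weight `(1 + ‖ξ‖²)^σ` leaves coefficient `1` on `‖g‖²`.
  have h0 : ‖fourierPairing σ g (piece f φ 0 ρ)‖ₑ ≤
      energy σ (piece f φ 0 ρ) + ∫⁻ ξ, ‖g ξ‖ₑ ^ 2 := by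
    refine (enorm_integral_fourier_mul_le σ _ g).trans ?_
    rw [energy, ← lintegral_add_left (measurable_energy_integrand _ _)]
    refine lintegral_mono fun ξ => ?_
    have hX : (0 : ℝ) < (1 + ‖ξ‖ ^ 2) ^ σ := by positivity
    have := mul_mul_le_weighted_sq (𝓕 (piece f φ 0 ρ) ξ) (g ξ)
      (w := (1 + ‖ξ‖ ^ 2) ^ (σ / 2)) (by positivity) hX
    rwa [← Real.rpow_mul_natCast (by positivity), Nat.cast_ofNat, div_mul_cancel₀ _ two_ne_zero,
      div_self hX.ne', ENNReal.ofReal_one, one_mul] at this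
  calc _ ≤ ‖fourierPairing σ g (piece f φ 0 ρ)‖ₑ +
        ∑ n ∈ Finset.range k, ‖fourierPairing σ g (piece f φ n ψ)‖ₑ :=
        (enorm_add_le _ _).trans (add_le_add le_rfl (enorm_sum_le _ _))
    _ ≤ (energy σ (piece f φ 0 ρ) + ∫⁻ ξ, ‖g ξ‖ₑ ^ 2) + (A + B * ∫⁻ ξ, ‖g ξ‖ₑ ^ 2) := by
        refine add_le_add h0 (le_trans ?_ (hAB g))
        exact (Finset.sum_le_sum fun n _ => enorm_integral_fourier_mul_le σ _ g).trans
          (ENNReal.sum_le_tsum _)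
    _ = _ := by ring

/-! ### Riesz representation and local Sobolev regularity -/

/-- Rescale `g` so that its image has norm at most one and use linearity. Dividing by `t > ‖e g‖`
and letting `t` decrease to `‖e g‖` also covers `e g = 0`. -/
theorem norm_le_of_le_add_sq {V W : Type*} [AddCommGroup V] [Module ℂ V]
    [SeminormedAddCommGroup W] [NormedSpace ℂ W] {S : V →ₗ[ℂ] ℂ} {e : V →ₗ[ℂ] W} {A B : ℝ}
    (h : ∀ g, ‖S g‖ ≤ A + B * ‖e g‖ ^ 2) (hB : 0 ≤ B) (g : V) :
    ‖S g‖ ≤ (A + B) * ‖e g‖ := by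
  have key : ∀ t : ℝ, ‖e g‖ < t → ‖S g‖ ≤ (A + B) * t := by
    intro t ht
    have ht0 : 0 < t := (norm_nonneg _).trans_lt ht
    have h1 := h ((t⁻¹ : ℂ) • g)
    rw [map_smul, map_smul, norm_smul, norm_smul, norm_inv, Complex.norm_of_nonneg ht0.le] at h1
    have h2 : t⁻¹ * ‖e g‖ ≤ 1 := by
      rw [inv_mul_le_iff₀ ht0, mul_one]
      exact ht.le
    have h3 : (t⁻¹ * ‖e g‖) ^ 2 ≤ 1 := pow_le_one₀ (by positivity) h2
    have h4 : t⁻¹ * ‖S g‖ ≤ A + B := h1.trans (by nlinarith)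
    rwa [inv_mul_le_iff₀ ht0, mul_comm] at h4
  refine ge_of_tendsto (b := ‖S g‖) (a := (A + B) * ‖e g‖) (f := fun t => (A + B) * t)
    (x := 𝓝[>] ‖e g‖) ?_ ?_
  · exact ((continuous_const.mul continuous_id).tendsto _).mono_left nhdsWithin_le_nhds
  · exact eventually_nhdsWithin_of_forall key

/-- By homogeneity `S` is bounded for the `L²` norm, so it extends from the dense Schwartz functions
and Riesz applies. The representative is conjugated because the inner product is conjugate-linear in
its first slot. -/
theorem exists_integral_eq_of_enorm_le {S : 𝓢(EuclideanSpace ℝ (Fin d), ℂ) →ₗ[ℂ] ℂ} {A B : ℝ≥0∞}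
    (hA : A ≠ ⊤) (hB : B ≠ ⊤) (h : ∀ g, ‖S g‖ₑ ≤ A + B * ∫⁻ ξ, ‖g ξ‖ₑ ^ 2) :
    ∃ u : Lp ℂ 2 (volume : Measure (EuclideanSpace ℝ (Fin d))),
      ∀ g : 𝓢(EuclideanSpace ℝ (Fin d), ℂ), S g = ∫ x, g x • u x := by
  set e : 𝓢(EuclideanSpace ℝ (Fin d), ℂ) →ₗ[ℂ]
    Lp ℂ 2 (volume : Measure (EuclideanSpace ℝ (Fin d))) :=
      (SchwartzMap.toLpCLM ℂ ℂ 2 volume).toLinearMap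
  have he : ∀ g, e g = g.toLp 2 volume := fun g => rfl
  have hdense : DenseRange e := SchwartzMap.denseRange_toLpCLM (by simp)
  have hb : ∀ g, ‖S g‖ ≤ A.toReal + B.toReal * ‖e g‖ ^ 2 := by
    intro g
    have h2 := eLpNorm_nnreal_pow_eq_lintegral (μ := volume) (f := g) (p := 2) (by simp)
    norm_num at h2
    have hg := (g.memLp 2 volume).2.ne
    have h3 := h g
    rw [← h2] at h3
    have h4 := ENNReal.toReal_mono (ENNReal.add_ne_top.2
      ⟨hA, ENNReal.mul_ne_top hB (ENNReal.pow_ne_top hg)⟩) h3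
    rwa [toReal_enorm, ENNReal.toReal_add hA (ENNReal.mul_ne_top hB (ENNReal.pow_ne_top hg)),
      ENNReal.toReal_mul, ENNReal.toReal_pow, ← SchwartzMap.norm_toLp, ← he] at h4
  have hS := fun g => LinearMap.extendOfNorm_eq hdense
    ⟨_, norm_le_of_le_add_sq hb ENNReal.toReal_nonneg⟩ g
  set v := (InnerProductSpace.toDual ℂ _).symm (S.extendOfNorm e)
  refine ⟨star v, fun g => ?_⟩
  rw [← hS g, ← InnerProductSpace.toDual_symm_apply, L2.inner_def]
  refine integral_congr_ae ?_
  filter_upwards [Lp.coeFn_star v, g.coeFn_toLp 2] with x h1 h2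
  rw [h1, he, h2]
  rfl

theorem SquareDecay.mem_sobolevLoc {f : 𝓓'(whole d, ℂ)} {m : ℕ} {σ : ℝ} (hσ : -1 < σ)
    (hf : SquareDecay f m σ) : f ∈ sobolevLoc d σ := by
  intro φ
  obtain ⟨A, B, hA, hB, hAB⟩ := exists_enorm_weightedPairing_le hσ hf φ
  obtain ⟨u, hu⟩ := exists_integral_eq_of_enorm_le hA hB hAB
  -- The tempered distribution is forced: `u` must be `(1 + ‖ξ‖²)^{σ/2}` times its Fourier
  -- transform.
  refine ⟨𝓕⁻ (TemperedDistribution.smulLeftCLM ℂ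
    (fun x => (((1 + ‖x‖ ^ 2) ^ (-σ / 2) : ℝ) : ℂ)) (Lp.toTemperedDistribution u)), ?_, ?_⟩
  · intro g
    change Lp.toTemperedDistribution u (weightCLM (-σ) (𝓕⁻ g)) = _
    rw [Lp.toTemperedDistribution_apply, ← hu, weightedPairing_apply, weightCLM_weightCLM_neg,
      FourierTransform.fourier_fourierInv_eq]
  · rw [TemperedDistribution.memSobolev_iff_exists_smulLeftCLM_fourier]
    refine ⟨u, ?_⟩
    rw [FourierTransform.fourier_fourierInv_eq]
    ext g
    change Lp.toTemperedDistribution u (weightCLM (-σ) (weightCLM σ g)) = _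
    have := weightCLM_weightCLM_neg (-σ) g
    rw [neg_neg] at this
    rw [this]

theorem sobolevLoc_anti {s t : ℝ} (h : s ≤ t) : sobolevLoc d t ⊆ sobolevLoc d s := by
  intro f hf φ
  obtain ⟨T, hT, hT2⟩ := hf φ
  exact ⟨T, hT, hT2.mono h⟩

end BesovSobolev

end

theorem mainTheorem5 (d : ℕ) (hd : 1 ≤ d) (α : ℝ) (hα : 0 ≤ α) (p : ℝ≥0∞) (hp : 2 ≤ p)
    (r : ℕ) (hr : -α < (r : ℝ)) :
    (∀ q : ℝ≥0∞, 2 < q → ∀ s : ℝ, s < α →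
      BesovSobolev.besovLoc d α p q r ⊆ BesovSobolev.sobolevLoc d s) ∧
    (∀ s : ℝ, s ≤ α →
      BesovSobolev.besovLoc d α p 2 r ⊆ BesovSobolev.sobolevLoc d s) := by
  refine ⟨fun q hq s hs f hf => ?_, fun s hs f hf => ?_⟩
  · have hσ : max s (-1 / 2) < α := max_lt hs (by linarith)
    have hf' := BesovSobolev.squareDecay_of_mem_besovLoc_of_lt hα hσ hp
      (zero_lt_two.trans hq).ne' hf
    exact BesovSobolev.sobolevLoc_anti (le_max_left _ _)
      (hf'.mem_sobolevLoc (lt_max_of_lt_right (by norm_num)))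
  · exact BesovSobolev.sobolevLoc_anti hs
      ((BesovSobolev.squareDecay_of_mem_besovLoc hα hp hf).mem_sobolevLoc (by linarith))
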